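/- Let $N\ge 1$. Put $\bar{\mathfrak t}=\bigoplus_{i=1}^N\mathbb C\epsilon_i^\vee$, $\mathfrak t'=\bar{\mathfrak t}\oplus\mathbb C c$ and $\alpha_{ij}=\epsilon_i-\epsilon_j$. For $\zeta\in(\mathfrak t')^*$ and $k\in\mathbb Z$ write $(\zeta,\alpha_{ij}+k\delta)=\zeta(\epsilon_i^\vee-\epsilon_j^\vee+kc)$ and $(\zeta,\delta)=\zeta(c)$. Let $\bar W=\mathfrak S_N$, $\bar P=\bigoplus_i\mathbb Z\epsilon_i$, and let $W=\bar W\ltimes\bar P$ be the extended affine Weyl group with translations $t_\eta$ ($\eta\in\bar P$). It acts on $\mathfrak t'$ by permutation of the $\epsilon_i^\vee$ and $t_\eta(\xi)=\xi-\eta(\xi)c$, and on $(\mathfrak t')^*$ by the affine action: $\bar W$ permutes coordinates and $t_\eta(\zeta)=\zeta+(\zeta,\delta)\eta$. It acts on the affine roots $\alpha_{ij}+k\delta$ ($i\neq j$, $k\in\mathbb Z$) by permutation of the indices and $t_\eta(\alpha_{ij}+k\delta)=\alpha_{ij}+(k-(\eta,\alpha_{ij}))\delta$; $l(w)$ is the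 number of positive affine roots sent by $w$ to negative ones, where $\alpha_{ij}+k\delta$ is positive if $i<j,\ k\ge 0$ or $i>j,\ k>0$. Let $s_i$ ($1\le i\le N-1$) be the transposition $(i\ i{+}1)$ with root $\alpha_i=\alpha_{i\,i+1}$, let $s_0=t_{\alpha_{1N}}s_{\alpha_{1N}}$ with $\alpha_0=\delta-\alpha_{1N}$ (for $N=1$, $s_0=1$ and $\alpha_0$ is zero on $\mathfrak t'$), and let $\pi=t_{\epsilon_1}s_1\cdots s_{N-1}$. Let $\mathcal H$ be the degenerate double affine Hecke algebra of $\mathfrak{gl}_N$, i.e. the unital associative $\mathbb C$-algebra generated by $\mathbb C[W]$ and $S[\mathfrak t']$ with the relations $s_i\xi-s_i(\xi)s_i=-\alpha_i(\xi)$ ($0\le i\le N-1$) and $\pi\xi=\pi(\xi)\pi$ for $\xi\in\mathfrak t'$ (so $\delta(\xi)=0$ in $\alpha_0(\xi)$). Let $\beta=(\beta_1,\dots,\beta_m)$ be an ordered partition of $N$ into positive parts, cutting $\{1,\dots,N\}$ into consecutive blocks of sizes $\beta_1,\dots,\beta_m$, and let $k_a=\sum_{i<a}\beta_i+1$ be the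 first element of the $a$-th block. Let $\bar W_\beta\subset\bar W$ be the subgroup generated by the $s_i$ with $i,i+1$ in the same block, $W^\beta=\{w\in W\mid l(wu)\ge l(w)\text{ for all }u\in\bar W_\beta\}$, and $(\mathfrak t')^*_\beta=\{\zeta\in(\mathfrak t')^*\mid(\zeta,\alpha_i)=-1\text{ whenever } i,i+1\text{ are in the same block}\}$. For $\zeta\in(\mathfrak t')^*_\beta$ let $\mathcal Y_\beta(\zeta)=\mathcal H\otimes_{\mathcal H_\beta}\mathbb C1_\zeta$, where $\mathcal H_\beta=S[\mathfrak t']\cdot\mathbb C[\bar W_\beta]$ acts on $\mathbb C1_\zeta$ by $w1_\zeta=1_\zeta$ ($w\in\bar W_\beta$) and $\xi1_\zeta=\zeta(\xi)1_\zeta$ ($\xi\in\mathfrak t'$); its cyclic vector $1\otimes1_\zeta$ is denoted $\mathbf 1_\zeta$. Suppose that $\zeta\in(\mathfrak t')^*_\beta$ satisfies $$(\zeta,\delta)\notin\mathbb Q_{\le0};$$ $$(\zeta,r\delta+\alpha_{k_ak_b})\notin\mathbb Z_{\le0}\quad\text{for all }1\le a<b\le m,\ r\in\mathbb Z_{\ge0};$$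 $$(\zeta,r\delta-\alpha_{k_ak_b})\notin\mathbb Z_{\le0}\quad\text{for all }1\le a<b\le m,\ r\in\mathbb Z_{>0}.$$ Then: 1. $w(\zeta)\ne\zeta$ for every $w\in W^\beta\setminus\{1\}$ (affine action). 2. $\mathbf 1_\zeta\neq0$, and the generalized $\zeta$-weight space of $\mathcal Y_\beta(\zeta)$ (the vectors killed, for each $\xi\in\mathfrak t'$, by some power of $\xi-\zeta(\xi)$) is $\mathbb C\,\mathbf 1_\zeta$. 3. $\mathcal Y_\beta(\zeta)$ has a unique irreducible quotient $\mathcal L_\beta(\zeta)$, i.e. there is exactly one $\mathcal H$-submodule $M$ of $\mathcal Y_\beta(\zeta)$ such that $\mathcal Y_\beta(\zeta)/M$ is irreducible. -/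

import Mathlib

noncomputable section

namespace DDAHA

variable (N : ℕ)

/-! ### The extended affine Weyl group -/

/-- The action of `W̄ = 𝔖_N` on the weight lattice `P̄ = ⨁ ℤ ε_i = (Fin N → ℤ)` (written
multiplicatively): `σ(ε_i) = ε_{σ(i)}`, that is `(σ η)_i = η_{σ⁻¹ i}`. -/
def latticeAction : Equiv.Perm (Fin N) →* MulAut (Multiplicative (Fin N → ℤ)) where
  toFun σ := AddEquiv.toMultiplicative (LinearEquiv.funCongrLeft ℤ ℤ σ⁻¹).toAddEquiv
  map_one' := by ext; rfl
  map_mul' _ _ := by ext; rfl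

/-- The (extended) affine Weyl group `W = W̄ ⋉ P̄` of `gl_N`. The element with components
`left = η`, `right = σ` is `t_η · σ`. -/
abbrev AffineWeyl : Type := Multiplicative (Fin N → ℤ) ⋊[latticeAction N] Equiv.Perm (Fin N)

variable {N}

/-- The translation `t_η`. -/
def translation (η : Fin N → ℤ) : AffineWeyl N :=
  SemidirectProduct.inl (Multiplicative.ofAdd η)

/-- The inclusion `W̄ ⊂ W`. -/
def ofPerm (σ : Equiv.Perm (Fin N)) : AffineWeyl N := SemidirectProduct.inr σ

/-- `η` for `w = t_η · σ`. -/
def shift (w : AffineWeyl N) : Fin N → ℤ := Multiplicative.toAdd w.left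

/-! ### The Cartan subalgebra and its dual -/

variable (N) in
/-- `𝔱' = 𝔱̄ ⊕ ℂ c`; the pair `(x, z)` is `∑ x_i ε_i^∨ + z c`. -/
abbrev Cartan : Type := (Fin N → ℂ) × ℂ

variable (N) in
/-- The dual space `(𝔱')^*`. -/
abbrev Weight : Type := Module.Dual ℂ (Cartan N)

variable (N) in
/-- The element `c` of `𝔱'`. -/
def c : Cartan N := (0, 1)

/-- The vector of `𝔱'` corresponding to `α_{ij} + k δ = ε_i - ε_j + k δ`, namely
`ε_i^∨ - ε_j^∨ + k c`. Thus `(ζ, α_{ij} + k δ) = ζ (coroot i j k)`, and `(ζ, δ) = ζ c`. -/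
def coroot (i j : Fin N) (k : ℤ) : Cartan N := (Pi.single i 1 - Pi.single j 1, (k : ℂ))

/-- `σ ∈ W̄` acting on `𝔱'`: it permutes the `ε_i^∨` and fixes `c`. -/
def permCartan (σ : Equiv.Perm (Fin N)) : Cartan N →ₗ[ℂ] Cartan N :=
  (LinearMap.funLeft ℂ ℂ (σ⁻¹ : Equiv.Perm (Fin N))).prodMap LinearMap.id

/-- `η ∈ P̄` as an element of `(𝔱')^*` (zero on `c`). -/
def latticeWeight (η : Fin N → ℤ) : Weight N :=
  (∑ i, (η i : ℂ) • LinearMap.proj i) ∘ₗ LinearMap.fst ℂ (Fin N → ℂ) ℂ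

/-- The action of `W` on `𝔱'`: `t_η(ξ) = ξ - η(ξ) c` (as `δ(ξ) = 0` on `𝔱'`), and `W̄` permutes
coordinates. -/
def actCartan (w : AffineWeyl N) (ξ : Cartan N) : Cartan N :=
  permCartan w.right ξ - latticeWeight (shift w) (permCartan w.right ξ) • c N

/-- The affine action of `W` on `(𝔱')^*`: `t_η(ζ) = ζ + (δ, ζ) η`, and `W̄` permutes
coordinates. -/
def affineAction (w : AffineWeyl N) (ζ : Weight N) : Weight N :=
  ζ ∘ₗ permCartan w.right⁻¹ + ζ (c N) • latticeWeight (shift w)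

/-! ### Roots and length -/

variable (N) in
/-- The affine roots `R`: the triple `(i, j, k)` with `i ≠ j` is `α_{ij} + k δ`. -/
def roots : Set (Fin N × Fin N × ℤ) := {α | α.1 ≠ α.2.1}

variable (N) in
/-- The positive roots `R_+`. -/
def posRoots : Set (Fin N × Fin N × ℤ) :=
  {α | (α.1 < α.2.1 ∧ 0 ≤ α.2.2) ∨ (α.2.1 < α.1 ∧ 0 < α.2.2)}

/-- The action of `W` on roots: `t_η(α_{ij} + k δ) = α_{ij} + (k - (η, α_{ij})) δ` and
`σ(α_{ij} + k δ) = α_{σ(i)σ(j)} + k δ`. -/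
def actRoot (w : AffineWeyl N) (α : Fin N × Fin N × ℤ) : Fin N × Fin N × ℤ :=
  (w.right α.1, w.right α.2.1, α.2.2 - (shift w (w.right α.1) - shift w (w.right α.2.1)))

/-- `S(w) = R_+ ∩ w⁻¹(R_-)`, where `R_- = R \ R_+`. -/
def inversions (w : AffineWeyl N) : Set (Fin N × Fin N × ℤ) :=
  {α | α ∈ posRoots N ∧ actRoot w α ∈ roots N \ posRoots N}

/-- The length `l(w) = #S(w)` (the set `S(w)` is finite). -/
def length (w : AffineWeyl N) : ℕ := (inversions w).ncard

/-- The affine reflection `s_α = t_{-k α_{ij}} s_{α_{ij}}` for `α = α_{ij} + k δ`. -/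
def reflection (i j : Fin N) (k : ℤ) : AffineWeyl N :=
  translation (-k • (Pi.single i 1 - Pi.single j 1)) * ofPerm (Equiv.swap i j)

/-- The simple reflections `s_i`, `i ∈ ℤ/N = Fin N`. With the `ε`'s numbered from `0`,
`α_i = α_{i-1,i}` for `i ≠ 0` and `α_0 = α_{N-1,0} + δ`; note that `0 - 1 = N - 1` in `Fin N`.
(For `N = 1` this gives `s_0 = 1`, and the relation for `s_0` below is void.) -/
def simpleReflection [NeZero N] (i : Fin N) : AffineWeyl N :=
  reflection (i - 1) i (if i = 0 then 1 else 0)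

variable (N) in
/-- `π = t_{ε_1} s_1 ⋯ s_{N-1}`, where `s_1 ⋯ s_{N-1}` is the cyclic permutation
`1 ↦ 2 ↦ ⋯ ↦ N ↦ 1`. -/
def piElt [NeZero N] : AffineWeyl N := translation (Pi.single 0 1) * ofPerm (finRotate N)

/-! ### The degenerate double affine Hecke algebra -/

variable (N) in
/-- Generators of the algebra: the elements of `W` and of `𝔱'`. -/
abbrev Pre : Type := FreeAlgebra ℂ (AffineWeyl N ⊕ Cartan N)

/-- The generator attached to `w ∈ W`. -/
def preW (w : AffineWeyl N) : Pre N := FreeAlgebra.ι ℂ (Sum.inl w)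

/-- The generator attached to `ξ ∈ 𝔱'`. -/
def preT (ξ : Cartan N) : Pre N := FreeAlgebra.ι ℂ (Sum.inr ξ)

variable (N) in
/-- The defining relations. The first two say that `ℂ[W]` maps to the algebra, the next three that
`S[𝔱']` does; the last two are the cross relations
`s_i ξ - s_i(ξ) s_i = -α_i(ξ)` for `i = 0, …, N-1` (where `α_i(ξ) = ξ_{i-1} - ξ_i` with indices
in `ℤ/N`, as `δ(ξ) = 0`), and `π ξ = π(ξ) π`. -/
inductive Rel [NeZero N] : Pre N → Pre N → Prop
  | one : Rel (preW 1) 1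
  | mul (w w' : AffineWeyl N) : Rel (preW (w * w')) (preW w * preW w')
  | add (ξ ξ' : Cartan N) : Rel (preT (ξ + ξ')) (preT ξ + preT ξ')
  | smul (a : ℂ) (ξ : Cartan N) : Rel (preT (a • ξ)) (a • preT ξ)
  | comm (ξ ξ' : Cartan N) : Rel (preT ξ * preT ξ') (preT ξ' * preT ξ)
  | simple (i : Fin N) (ξ : Cartan N) :
      Rel (preW (simpleReflection i) * preT ξ -
            preT (actCartan (simpleReflection i) ξ) * preW (simpleReflection i))
        (algebraMap ℂ (Pre N) (-(ξ.1 (i - 1) - ξ.1 i)))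
  | pi (ξ : Cartan N) :
      Rel (preW (piElt N) * preT ξ) (preT (actCartan (piElt N) ξ) * preW (piElt N))

variable (N) in
/-- The degenerate double affine Hecke algebra `H` of `gl_N`: the algebra generated by `ℂ[W]` and
`S[𝔱']` with the cross relations. -/
def Hecke [NeZero N] : Type := RingQuot (Rel N)

instance [NeZero N] : Ring (Hecke N) := inferInstanceAs (Ring (RingQuot (Rel N)))

instance [NeZero N] : Algebra ℂ (Hecke N) := inferInstanceAs (Algebra ℂ (RingQuot (Rel N)))

/-- The image of `w ∈ W` in `H`. -/
def ofW [NeZero N] (w : AffineWeyl N) : Hecke N := RingQuot.mkAlgHom ℂ (Rel N) (preW w)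

/-- The image of `ξ ∈ 𝔱'` in `H`. -/
def ofT [NeZero N] (ξ : Cartan N) : Hecke N := RingQuot.mkAlgHom ℂ (Rel N) (preT ξ)

/-! ### Weight spaces -/

/-- The generalized `ζ`-weight space of an `H`-module `V`: the vectors killed, for every `ξ ∈ 𝔱'`,
by a power of `ξ - ζ(ξ)`. -/
def genWeightSpace [NeZero N] (V : Type*) [AddCommGroup V] [Module ℂ V] [Module (Hecke N) V]
    [IsScalarTower ℂ (Hecke N) V] (ζ : Weight N) : Submodule ℂ V :=
  ⨅ ξ : Cartan N, Module.End.maxGenEigenspace (Algebra.lsmul ℂ ℂ V (ofT ξ)) (ζ ξ)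

/-! ### Induced modules -/

/-- The parabolic subgroup `W̄_β` of `W̄`, generated by the simple reflections `s_α` with
`α = α_{i,i+1}`, `i` and `i + 1` in the same block of `β`. -/
def parabolic (β : Composition N) : Subgroup (Equiv.Perm (Fin N)) :=
  Subgroup.closure {σ | ∃ i j : Fin N, (i : ℕ) + 1 = j ∧ β.index i = β.index j ∧
    σ = Equiv.swap i j}

/-- `(𝔱')^*_β`: the weights with `(ζ, α) = -1` for every simple root `α = α_{i,i+1}` such that `i`
and `i + 1` lie in the same block of `β`. -/
def weightsBeta (β : Composition N) : Set (Weight N) :=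
  {ζ | ∀ i j : Fin N, (i : ℕ) + 1 = j → β.index i = β.index j → ζ (coroot i j 0) = -1}

/-- `W^β`: the elements `w` with `l(w u) ≥ l(w)` for all `u ∈ W̄_β`. -/
def minimalReps (β : Composition N) : Set (AffineWeyl N) :=
  {w | ∀ u ∈ parabolic β, length w ≤ length (w * ofPerm u)}

/-- The left ideal of `H` generated by `w - 1` (`w ∈ W̄_β`) and `ξ - ζ(ξ)` (`ξ ∈ 𝔱'`), i.e. by the
kernel of the character of `H_β` on `ℂ 1_ζ`. -/
def inducedIdeal [NeZero N] (β : Composition N) (ζ : Weight N) :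
    Submodule (Hecke N) (Hecke N) :=
  Submodule.span (Hecke N)
    ({h | ∃ u ∈ parabolic β, h = ofW (ofPerm u) - 1} ∪
      {h | ∃ ξ : Cartan N, h = ofT ξ - algebraMap ℂ (Hecke N) (ζ ξ)})

/-- The induced module `Y_β(ζ) = H ⊗_{H_β} ℂ 1_ζ`, presented as the quotient of `H` by the left
ideal generated by the annihilator of `1_ζ` in `H_β`. -/
abbrev Induced [NeZero N] (β : Composition N) (ζ : Weight N) : Type :=
  Hecke N ⧸ inducedIdeal β ζ

/-- The cyclic vector `1_ζ = 1 ⊗ 1_ζ` of `Y_β(ζ)`. -/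
def cyclicVector [NeZero N] (β : Composition N) (ζ : Weight N) : Induced β ζ :=
  Submodule.Quotient.mk 1

/-! ### The condition on the weight -/

/-- The first index `k_a` of the `a`-th block of `β` (numbering from `0`). -/
def blockStart (β : Composition N) (a : Fin β.length) : Fin N :=
  β.embedding a ⟨0, β.blocks_pos' a a.2⟩

/-- `(ζ, δ) ∉ ℚ_{≤0}`; `(ζ, rδ + α_{k_a k_b}) ∉ ℤ_{≤0}` for `a < b`, `r ≥ 0`;
`(ζ, rδ - α_{k_a k_b}) ∉ ℤ_{≤0}` for `a < b`, `r > 0`. -/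
structure DominanceCondition (β : Composition N) (ζ : Weight N) : Prop where
  level : ∀ q : ℚ, q ≤ 0 → ζ (c N) ≠ (q : ℂ)
  pos : ∀ a b : Fin β.length, a < b → ∀ r : ℤ, 0 ≤ r → ∀ n : ℤ, n ≤ 0 →
    ζ (coroot (blockStart β a) (blockStart β b) r) ≠ (n : ℂ)
  neg : ∀ a b : Fin β.length, a < b → ∀ r : ℤ, 0 < r → ∀ n : ℤ, n ≤ 0 →
    ζ (coroot (blockStart β b) (blockStart β a) r) ≠ (n : ℂ)

end DDAHA

end

noncomputable section

namespace DDAHA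

variable {N : ℕ}

/-! ### The actions of the affine Weyl group -/

/-! The argument is a triangularity argument on the spanning vectors `ofW w • cyclicVector β ζ`. In
the Hecke algebra, ξ·w = w·w⁻¹(ξ) − ∑ α(ξ) s_α w, the sum running over the positive roots α made
negative by w⁻¹ (`ofT_mul_ofW`). Hence ξ acts on the vector of w by the scalar (wζ)(ξ), up to
vectors of elements s_α w. These are closer to the identity: the hyperplane of α separates a fixed
point of the fundamental alcove from its image under w, and reflecting in it decreases the distance
between the two (`displacement_rootReflection_mul_lt`). This distance replaces the Bruhat order.

The combinatorial core is `eq_one_of_affineAction_eq`: if w sends the simple roots inside the blocks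
to positive roots and fixes ζ, then w = 1. Within a block the coordinates of ζ increase by 1 at each
step, so a coordinate is its block's leading coordinate plus a position. The dominance condition
says that an equality of coordinates modulo multiples of ζ(c) forces the position to rise when the
shift is positive, or is zero and the block moves right. Induction on the position then shows that w
fixes every index with zero shift.

Consequently every w either can be replaced by a closer element giving the same vector, or is 1, or
has wζ ≠ ζ. By induction on the distance the module is the line of the cyclic vector plus the space
of vectors killed by a product of factors ξ − a with a ≠ ζ(ξ)
(`span_cyclicVector_sup_offWeightSpace`). Such factors are injective on the generalized ζ-weight
space, so that space is the line. A proper submodule cannot meet the complement of the second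
summand, since it would then contain the cyclic vector. So there is a largest proper submodule.

That the cyclic vector is nonzero needs a model. The commutation formula is taken as the definition
of an action on ℂ[W], its relations are checked, and the kernel of ℂ[W] → ℂ[W/W̄_β] is shown to be
stable. The stability is where (ζ, α_i) = −1 enters (`cartanOp_mem_parabolicKernel_of_pos`). -/

theorem shift_one : shift (1 : AffineWeyl N) = 0 := rfl

theorem shift_mul (w v : AffineWeyl N) (i : Fin N) :
    shift (w * v) i = shift w i + shift v (w.right⁻¹ i) := rfl

theorem shift_translation (η : Fin N → ℤ) : shift (translation η) = η := rfl

theorem shift_ofPerm (σ : Equiv.Perm (Fin N)) : shift (ofPerm σ) = 0 := rfl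

theorem right_translation (η : Fin N → ℤ) : (translation η).right = 1 := rfl

theorem right_ofPerm (σ : Equiv.Perm (Fin N)) : (ofPerm σ).right = σ := rfl

theorem affineWeyl_ext {w v : AffineWeyl N} (h : w.right = v.right)
    (h' : ∀ i, shift w i = shift v i) : w = v :=
  SemidirectProduct.ext (Multiplicative.toAdd.injective (funext h')) h

theorem ofPerm_mul (σ τ : Equiv.Perm (Fin N)) : ofPerm (σ * τ) = ofPerm σ * ofPerm τ :=
  map_mul SemidirectProduct.inr σ τ

theorem ofPerm_one : ofPerm (1 : Equiv.Perm (Fin N)) = 1 := map_one SemidirectProduct.inr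

theorem actRoot_one (α : Fin N × Fin N × ℤ) : actRoot 1 α = α := by
  simp [actRoot, shift_one]

theorem actRoot_mul (w v : AffineWeyl N) (α : Fin N × Fin N × ℤ) :
    actRoot (w * v) α = actRoot w (actRoot v α) := by
  simp only [actRoot, shift_mul, SemidirectProduct.mul_right, Equiv.Perm.mul_apply,
    Prod.mk.injEq, true_and]
  rw [show ∀ x, w.right⁻¹ (w.right x) = x from w.right.symm_apply_apply,
    show ∀ x, w.right⁻¹ (w.right x) = x from w.right.symm_apply_apply]
  ring

theorem actRoot_inv_actRoot (w : AffineWeyl N) (α : Fin N × Fin N × ℤ) :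
    actRoot w⁻¹ (actRoot w α) = α := by
  rw [← actRoot_mul, inv_mul_cancel, actRoot_one]

theorem actRoot_actRoot_inv (w : AffineWeyl N) (α : Fin N × Fin N × ℤ) :
    actRoot w (actRoot w⁻¹ α) = α := by
  rw [← actRoot_mul, mul_inv_cancel, actRoot_one]

theorem actRoot_injective (w : AffineWeyl N) : Function.Injective (actRoot w) :=
  Function.LeftInverse.injective (actRoot_inv_actRoot w)

theorem actCartan_fst (w : AffineWeyl N) (ξ : Cartan N) (i : Fin N) :
    (actCartan w ξ).1 i = ξ.1 (w.right⁻¹ i) := by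
  simp [actCartan, permCartan, c, LinearMap.funLeft]

theorem actCartan_snd (w : AffineWeyl N) (ξ : Cartan N) :
    (actCartan w ξ).2 = ξ.2 - ∑ i, (shift w i : ℂ) * ξ.1 (w.right⁻¹ i) := by
  simp [actCartan, permCartan, c, LinearMap.funLeft, latticeWeight]

theorem actCartan_one (ξ : Cartan N) : actCartan 1 ξ = ξ := by
  ext i
  · simp [actCartan_fst]
  · simp [actCartan_snd, shift_one]

theorem actCartan_mul (w v : AffineWeyl N) (ξ : Cartan N) :
    actCartan (w * v) ξ = actCartan w (actCartan v ξ) := by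
  ext i
  · simp [actCartan_fst]
  · simp only [actCartan_snd, actCartan_fst, shift_mul, SemidirectProduct.mul_right, mul_inv_rev,
      Equiv.Perm.mul_apply, Int.cast_add, add_mul, Finset.sum_add_distrib]
    rw [Equiv.sum_comp w.right⁻¹ (fun i => (shift v i : ℂ) * ξ.1 (v.right⁻¹ i))]
    ring

theorem actCartan_add (w : AffineWeyl N) (ξ ξ' : Cartan N) :
    actCartan w (ξ + ξ') = actCartan w ξ + actCartan w ξ' := by
  ext i
  · simp [actCartan_fst]
  · simp only [actCartan_snd, Prod.snd_add, Prod.fst_add, Pi.add_apply, mul_add,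
      Finset.sum_add_distrib]
    ring

theorem actCartan_smul (w : AffineWeyl N) (a : ℂ) (ξ : Cartan N) :
    actCartan w (a • ξ) = a • actCartan w ξ := by
  ext i
  · simp [actCartan_fst]
  · simp only [actCartan_snd, Prod.smul_snd, Prod.smul_fst, Pi.smul_apply, smul_eq_mul, mul_sub,
      Finset.mul_sum]
    congr 1
    exact Finset.sum_congr rfl fun i _ => by ring

theorem affineAction_apply (w : AffineWeyl N) (ζ : Weight N) (ξ : Cartan N) :
    affineAction w ζ ξ = ζ (actCartan w⁻¹ ξ) := by
  have h : actCartan w⁻¹ ξ = permCartan w.right⁻¹ ξ + latticeWeight (shift w) ξ • c N := by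
    ext i
    · simp [actCartan_fst, permCartan, c, LinearMap.funLeft]
    · rw [actCartan_snd]
      have hs : ∀ i, shift w⁻¹ i = -shift w (w.right i) := by
        intro i
        have := shift_mul w⁻¹ w i
        rw [inv_mul_cancel, shift_one] at this
        simp only [Pi.zero_apply, SemidirectProduct.inv_right, inv_inv] at this
        omega
      simp only [hs, SemidirectProduct.inv_right, inv_inv, Int.cast_neg, neg_mul,
        Finset.sum_neg_distrib]
      rw [Equiv.sum_comp w.right (fun i => (shift w i : ℂ) * ξ.1 i)]
      simp [permCartan, latticeWeight, c]
  rw [h, map_add, map_smul, affineAction]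
  simp [mul_comm]

/-- The value of the finite part of a root on `𝔱'`; since `δ` vanishes on `𝔱'` this is the value of
the root itself. -/
def rootVal (α : Fin N × Fin N × ℤ) (ξ : Cartan N) : ℂ := ξ.1 α.1 - ξ.1 α.2.1

/-- The root `-α`. -/
def negRoot (α : Fin N × Fin N × ℤ) : Fin N × Fin N × ℤ := (α.2.1, α.1, -α.2.2)

/-- The reflection `s_α`. -/
def rootReflection (α : Fin N × Fin N × ℤ) : AffineWeyl N := reflection α.1 α.2.1 α.2.2

theorem rootVal_actRoot (w : AffineWeyl N) (α : Fin N × Fin N × ℤ) (ξ : Cartan N) :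
    rootVal (actRoot w α) ξ = rootVal α (actCartan w⁻¹ ξ) := by
  simp [rootVal, actRoot, actCartan_fst]

theorem rootVal_add (α : Fin N × Fin N × ℤ) (ξ ξ' : Cartan N) :
    rootVal α (ξ + ξ') = rootVal α ξ + rootVal α ξ' := by
  simp only [rootVal, Prod.fst_add, Pi.add_apply]; ring

theorem rootVal_smul (α : Fin N × Fin N × ℤ) (a : ℂ) (ξ : Cartan N) :
    rootVal α (a • ξ) = a * rootVal α ξ := by
  simp only [rootVal, Prod.smul_fst, Pi.smul_apply, smul_eq_mul]; ring

theorem rootVal_negRoot (α : Fin N × Fin N × ℤ) (ξ : Cartan N) :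
    rootVal (negRoot α) ξ = -rootVal α ξ := by
  simp [rootVal, negRoot]

theorem actRoot_negRoot (w : AffineWeyl N) (α : Fin N × Fin N × ℤ) :
    actRoot w (negRoot α) = negRoot (actRoot w α) := by
  simp only [actRoot, negRoot, Prod.mk.injEq, true_and]; ring

theorem right_rootReflection (α : Fin N × Fin N × ℤ) :
    (rootReflection α).right = Equiv.swap α.1 α.2.1 := by
  simp [rootReflection, reflection, right_translation, right_ofPerm]

theorem shift_rootReflection (α : Fin N × Fin N × ℤ) (i : Fin N) :
    shift (rootReflection α) i
      = -α.2.2 * ((if i = α.1 then 1 else 0) - (if i = α.2.1 then 1 else 0)) := by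
  simp [rootReflection, reflection, shift_mul, shift_translation, shift_ofPerm, Pi.single_apply]

theorem rootReflection_negRoot (α : Fin N × Fin N × ℤ) :
    rootReflection (negRoot α) = rootReflection α := by
  refine affineWeyl_ext ?_ fun i => ?_
  · simp [right_rootReflection, negRoot, Equiv.swap_comm]
  · simp only [shift_rootReflection, negRoot]; ring

theorem mul_rootReflection (w : AffineWeyl N) (α : Fin N × Fin N × ℤ) :
    w * rootReflection α = rootReflection (actRoot w α) * w := by
  refine affineWeyl_ext ?_ fun i => ?_
  · simp only [SemidirectProduct.mul_right, right_rootReflection, actRoot]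
    rw [Equiv.swap_apply_apply]; group
  · simp only [shift_mul, shift_rootReflection, right_rootReflection, actRoot, Equiv.swap_inv]
    simp only [Equiv.Perm.inv_eq_iff_eq]
    by_cases h1 : i = w.right α.1
    · subst h1
      by_cases h2 : α.1 = α.2.1
      · simp [h2]
      · simp [h2]; ring
    · by_cases h2 : i = w.right α.2.1
      · subst h2
        have : ¬ α.2.1 = α.1 := fun h => h1 (by rw [h])
        simp [this]; ring
      · simp [h1, h2, Equiv.swap_apply_of_ne_of_ne]

theorem rootReflection_mul_self (α : Fin N × Fin N × ℤ) :
    rootReflection α * rootReflection α = 1 := by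
  refine affineWeyl_ext ?_ fun i => ?_
  · simp [right_rootReflection]
  · simp only [shift_mul, shift_rootReflection, right_rootReflection, Equiv.swap_inv]
    have h1 : Equiv.swap α.1 α.2.1 i = α.1 ↔ i = α.2.1 := by
      rw [← Equiv.eq_symm_apply]; simp
    have h2 : Equiv.swap α.1 α.2.1 i = α.2.1 ↔ i = α.1 := by
      rw [← Equiv.eq_symm_apply]; simp
    simp only [shift_one, Pi.zero_apply, h1, h2]; ring

/-! ### Positivity, inversions and the simple reflections -/

theorem negRoot_mem_posRoots_iff {α : Fin N × Fin N × ℤ} (h : α.1 ≠ α.2.1) :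
    negRoot α ∈ posRoots N ↔ α ∉ posRoots N := by
  simp only [posRoots, Set.mem_ofPred_eq, negRoot]
  omega

theorem ne_of_mem_posRoots {α : Fin N × Fin N × ℤ} (h : α ∈ posRoots N) : α.1 ≠ α.2.1 := by
  simp only [posRoots, Set.mem_ofPred_eq] at h
  omega

theorem actRoot_ne (w : AffineWeyl N) {α : Fin N × Fin N × ℤ} (h : α.1 ≠ α.2.1) :
    (actRoot w α).1 ≠ (actRoot w α).2.1 := fun h' => h (w.right.injective h')

theorem mem_inversions {w : AffineWeyl N} {α : Fin N × Fin N × ℤ} :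
    α ∈ inversions w ↔ α ∈ posRoots N ∧ actRoot w α ∉ posRoots N :=
  ⟨fun h => ⟨h.1, h.2.2⟩, fun h => ⟨h.1, actRoot_ne w (ne_of_mem_posRoots h.1), h.2⟩⟩

theorem inversions_finite (w : AffineWeyl N) : (inversions w).Finite := by
  let B : ℤ := ∑ i, |shift w i|
  have hB : ∀ i, |shift w i| ≤ B := fun i =>
    Finset.single_le_sum (f := fun i => |shift w i|) (fun i _ => abs_nonneg _) (Finset.mem_univ i)
  -- The action of w changes the δ-coefficient by at most `2 * B`, so a positive root can become
  -- negative only if its coefficient lies in `[0, 2 * B]`.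
  refine Set.Finite.subset (s := Set.univ ×ˢ Set.univ ×ˢ Set.Icc 0 (2 * B))
    (Set.finite_univ.prod (Set.finite_univ.prod (Set.finite_Icc _ _))) fun α hα => ?_
  rw [mem_inversions] at hα
  obtain ⟨h1, h2⟩ := hα
  have h3 := (negRoot_mem_posRoots_iff (actRoot_ne w (ne_of_mem_posRoots h1))).2 h2
  have h4 := abs_le.1 (hB (w.right α.1))
  have h5 := abs_le.1 (hB (w.right α.2.1))
  simp only [posRoots, Set.mem_ofPred_eq, negRoot, actRoot] at h1 h3
  simp only [Set.mem_prod, Set.mem_univ, true_and, Set.mem_Icc]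
  omega

/-- The finite set `S(w)`. -/
def inversionFinset (w : AffineWeyl N) : Finset (Fin N × Fin N × ℤ) :=
  (inversions_finite w).toFinset

theorem mem_inversionFinset {w : AffineWeyl N} {α : Fin N × Fin N × ℤ} :
    α ∈ inversionFinset w ↔ α ∈ posRoots N ∧ actRoot w α ∉ posRoots N := by
  rw [inversionFinset, Set.Finite.mem_toFinset, mem_inversions]

theorem length_eq_card (w : AffineWeyl N) : length w = (inversionFinset w).card :=
  Set.ncard_eq_toFinset_card _ _

/-- The hypothesis covers the finite simple roots (e = 0) and the affine one (e = 1) together. No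
integer lies strictly between adjacent indices, or outside the range from first to last, so no other
positive root can change sign. -/
theorem actRoot_rootReflection_mem_posRoots {i j : Fin N} {e : ℤ}
    (h : (e = 0 ∧ (j : ℕ) + 1 = i) ∨ (e = 1 ∧ (j : ℕ) = N - 1 ∧ (i : ℕ) = 0)) (hij : j ≠ i)
    {α : Fin N × Fin N × ℤ} (hα : α ∈ posRoots N) (hne : α ≠ (j, i, e)) :
    actRoot (rootReflection (j, i, e)) α ∈ posRoots N := by
  obtain ⟨a, b, k⟩ := α
  have hw : ∀ x : Fin N, (rootReflection (j, i, e)).right x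
      = if x = j then i else if x = i then j else x := fun x => by
    rw [right_rootReflection, Equiv.swap_apply_def]
  have hs : ∀ x : Fin N, shift (rootReflection (j, i, e)) x = -e
      * ((if x = j then 1 else 0) - (if x = i then 1 else 0)) := fun x => shift_rootReflection _ x
  have ha := a.isLt
  have hb := b.isLt
  simp only [posRoots, Set.mem_ofPred_eq, actRoot, hw, hs, ne_eq, Prod.mk.injEq, Fin.lt_def] at *
  have hij' : (j : ℕ) ≠ i := fun h => hij (Fin.ext h)
  have hij'' : ¬ i = j := fun h => hij h.symm
  -- Each inequality is recorded both in `Fin N` and in ℕ: the first form resolves the conditionals,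
  -- the second feeds the linear arithmetic.
  have key : ∀ x : Fin N, (x = j ∨ x = i) ∨ (x ≠ j ∧ x ≠ i ∧ (x : ℕ) ≠ j ∧ (x : ℕ) ≠ i) := by
    intro x
    simp only [ne_eq, Fin.ext_iff]
    omega
  rcases key a with (a1 | a1) | ⟨a1, a2, a3, a4⟩ <;>
    rcases key b with (b1 | b1) | ⟨b1, b2, b3, b4⟩ <;>
    simp only [if_true, if_false, true_and, false_and, *] at hα hne ⊢ <;>
    omega

section Simple

variable [NeZero N]

/-- The simple roots. -/
def simpleRoot (i : Fin N) : Fin N × Fin N × ℤ := (i - 1, i, if i = 0 then 1 else 0)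

theorem simpleReflection_eq (i : Fin N) : simpleReflection i = rootReflection (simpleRoot i) := rfl

theorem val_sub_one (i : Fin N) : ((i - 1 : Fin N) : ℕ) = if i = 0 then N - 1 else (i : ℕ) - 1 := by
  have hN : 0 < N := Nat.pos_of_ne_zero (NeZero.ne N)
  obtain ⟨n, rfl⟩ : ∃ n, N = n + 1 := ⟨N - 1, by omega⟩
  rw [Fin.coe_sub_one]
  simp

theorem simpleRoot_mem_posRoots {i : Fin N} (h : i - 1 ≠ i) : simpleRoot i ∈ posRoots N := by
  have h1 := val_sub_one i
  have hN := i.isLt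
  simp only [posRoots, Set.mem_ofPred_eq, simpleRoot, ne_eq, Fin.ext_iff, Fin.lt_def] at *
  have h0 : ((0 : Fin N) : ℕ) = 0 := Fin.val_zero N
  split_ifs at * <;> omega

theorem actRoot_simpleReflection_mem_posRoots {i : Fin N} (h : i - 1 ≠ i)
    {α : Fin N × Fin N × ℤ} (hα : α ∈ posRoots N) (hne : α ≠ simpleRoot i) :
    actRoot (simpleReflection i) α ∈ posRoots N := by
  refine actRoot_rootReflection_mem_posRoots ?_ h hα hne
  have h1 := val_sub_one i
  have h0 : ((0 : Fin N) : ℕ) = 0 := Fin.val_zero N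
  by_cases hi : i = 0
  · rw [if_pos hi] at h1
    exact Or.inr ⟨if_pos hi, h1, by rw [hi, h0]⟩
  · rw [if_neg hi] at h1
    have : (i : ℕ) ≠ 0 := fun h => hi (Fin.ext (h.trans h0.symm))
    exact Or.inl ⟨if_neg hi, by omega⟩

end Simple

end DDAHA

end

noncomputable section

namespace DDAHA

variable {N : ℕ}

/-! ### Inversion sets under multiplication by simple reflections. -/

theorem actRoot_rootReflection_self {α : Fin N × Fin N × ℤ} (h : α.1 ≠ α.2.1) :
    actRoot (rootReflection α) α = negRoot α := by
  simp only [actRoot, right_rootReflection, shift_rootReflection, negRoot,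
    Equiv.swap_apply_left, Equiv.swap_apply_right, Prod.mk.injEq, true_and, h, h.symm, if_true,
    if_false]
  ring

theorem rootReflection_inv (α : Fin N × Fin N × ℤ) : (rootReflection α)⁻¹ = rootReflection α :=
  inv_eq_of_mul_eq_one_left (rootReflection_mul_self α)

section Simple

variable [NeZero N]

theorem simpleReflection_mul_self (i : Fin N) :
    simpleReflection i * simpleReflection i = 1 := by
  rw [simpleReflection_eq, rootReflection_mul_self]

theorem simpleReflection_inv (i : Fin N) : (simpleReflection i)⁻¹ = simpleReflection i := by
  rw [simpleReflection_eq, rootReflection_inv]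

theorem actRoot_simpleReflection_simpleRoot {i : Fin N} (h : i - 1 ≠ i) :
    actRoot (simpleReflection i) (simpleRoot i) = negRoot (simpleRoot i) := by
  rw [simpleReflection_eq, actRoot_rootReflection_self (α := simpleRoot i) h]

theorem actRoot_simpleReflection_twice (i : Fin N) (α : Fin N × Fin N × ℤ) :
    actRoot (simpleReflection i) (actRoot (simpleReflection i) α) = α := by
  rw [← actRoot_mul, simpleReflection_mul_self, actRoot_one]

theorem actRoot_simpleReflection_ne {i : Fin N} (h : i - 1 ≠ i) {α : Fin N × Fin N × ℤ}
    (hα : α ∈ posRoots N) : actRoot (simpleReflection i) α ≠ simpleRoot i := by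
  intro h'
  have h2 : α = negRoot (simpleRoot i) := by
    rw [← actRoot_simpleReflection_simpleRoot h, ← h', actRoot_simpleReflection_twice]
  rw [h2, negRoot_mem_posRoots_iff h] at hα
  exact hα (simpleRoot_mem_posRoots h)

theorem inversionFinset_mul_simpleReflection {i : Fin N} (h : i - 1 ≠ i) {v : AffineWeyl N}
    (hv : actRoot v (simpleRoot i) ∈ posRoots N) :
    inversionFinset (v * simpleReflection i) =
      insert (simpleRoot i) ((inversionFinset v).image (actRoot (simpleReflection i))) := by
  ext α
  simp only [mem_inversionFinset, Finset.mem_insert, Finset.mem_image, actRoot_mul]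
  constructor
  · rintro ⟨h1, h2⟩
    by_cases hα : α = simpleRoot i
    · exact Or.inl hα
    · exact Or.inr ⟨_, ⟨actRoot_simpleReflection_mem_posRoots h h1 hα, h2⟩,
        actRoot_simpleReflection_twice i α⟩
  · rintro (rfl | ⟨γ, ⟨h1, h2⟩, rfl⟩)
    · refine ⟨simpleRoot_mem_posRoots h, ?_⟩
      rw [actRoot_simpleReflection_simpleRoot h, actRoot_negRoot,
        negRoot_mem_posRoots_iff (actRoot_ne v h)]
      exact not_not.2 hv
    · rw [actRoot_simpleReflection_twice]
      exact ⟨actRoot_simpleReflection_mem_posRoots h h1 fun hγ => h2 (hγ ▸ hv), h2⟩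

theorem simpleRoot_notMem_image {i : Fin N} (h : i - 1 ≠ i) (v : AffineWeyl N) :
    simpleRoot i ∉ (inversionFinset v).image (actRoot (simpleReflection i)) := by
  simp only [Finset.mem_image, not_exists, not_and, mem_inversionFinset]
  exact fun α hα => actRoot_simpleReflection_ne h hα.1

theorem sum_inversionFinset_mul_of_pos {M : Type*} [AddCommGroup M] {i : Fin N} (h : i - 1 ≠ i)
    {v : AffineWeyl N} (hv : actRoot v (simpleRoot i) ∈ posRoots N)
    (f : Fin N × Fin N × ℤ → M) :
    ∑ α ∈ inversionFinset (v * simpleReflection i), f α =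
      f (simpleRoot i) + ∑ α ∈ inversionFinset v, f (actRoot (simpleReflection i) α) := by
  rw [inversionFinset_mul_simpleReflection h hv, Finset.sum_insert (simpleRoot_notMem_image h v),
    Finset.sum_image fun _ _ _ _ h => actRoot_injective _ h]

/-- For odd summands the formula needs no assumption on whether the length goes up or down. If it
goes down, the formula for v s_i gives the extra term at −α_i on the other side, and oddness moves
it back. Inductions over arbitrary words in the generators thus need no reduced expressions. -/
theorem sum_inversionFinset_mul_simpleReflection {M : Type*} [AddCommGroup M] {i : Fin N}
    (h : i - 1 ≠ i) (v : AffineWeyl N) {f : Fin N × Fin N × ℤ → M}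
    (hf : ∀ α, f (negRoot α) = -f α) :
    ∑ α ∈ inversionFinset (v * simpleReflection i), f α =
      f (simpleRoot i) + ∑ α ∈ inversionFinset v, f (actRoot (simpleReflection i) α) := by
  by_cases hv : actRoot v (simpleRoot i) ∈ posRoots N
  · exact sum_inversionFinset_mul_of_pos h hv f
  · have hv' : actRoot (v * simpleReflection i) (simpleRoot i) ∈ posRoots N := by
      rw [actRoot_mul, actRoot_simpleReflection_simpleRoot h, actRoot_negRoot,
        negRoot_mem_posRoots_iff (actRoot_ne v h)]
      exact hv
    have := sum_inversionFinset_mul_of_pos h hv' fun α => f (actRoot (simpleReflection i) α)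
    rw [mul_assoc, simpleReflection_mul_self, mul_one] at this
    rw [this, actRoot_simpleReflection_simpleRoot h, hf]
    simp only [actRoot_simpleReflection_twice]
    abel

/-- Only the root that v sends to α_i has its sign affected by a further s_i, because s_i permutes
the remaining positive roots. -/
theorem inversionFinset_simpleReflection_mul {i : Fin N} (h : i - 1 ≠ i) {v : AffineWeyl N}
    {α : Fin N × Fin N × ℤ} (hα : α ∈ posRoots N) (hv : actRoot v α = simpleRoot i) :
    inversionFinset (simpleReflection i * v) = insert α (inversionFinset v) := by
  ext γ
  simp only [mem_inversionFinset, Finset.mem_insert, actRoot_mul]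
  constructor
  · rintro ⟨h1, h2⟩
    by_cases h3 : actRoot v γ ∈ posRoots N
    · refine Or.inl (actRoot_injective v (hv ▸ ?_))
      by_contra h4
      exact h2 (actRoot_simpleReflection_mem_posRoots h h3 h4)
    · exact Or.inr ⟨h1, h3⟩
  · rintro (rfl | ⟨h1, h2⟩)
    · rw [hv, actRoot_simpleReflection_simpleRoot h, negRoot_mem_posRoots_iff h]
      exact ⟨hα, not_not.2 (simpleRoot_mem_posRoots h)⟩
    · refine ⟨h1, ?_⟩
      have h3 := actRoot_ne v (ne_of_mem_posRoots h1)
      rw [← negRoot_mem_posRoots_iff h3] at h2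
      rw [← negRoot_mem_posRoots_iff (actRoot_ne _ h3), ← actRoot_negRoot]
      refine actRoot_simpleReflection_mem_posRoots h h2 fun h4 => ?_
      rw [← actRoot_negRoot, ← hv] at h4
      have h5 := actRoot_injective v h4
      rw [← h5, negRoot_mem_posRoots_iff (ne_of_mem_posRoots h1)] at hα
      exact hα h1

theorem notMem_inversionFinset_of_actRoot_eq {i : Fin N} (h : i - 1 ≠ i) {v : AffineWeyl N}
    {α : Fin N × Fin N × ℤ} (hv : actRoot v α = simpleRoot i) : α ∉ inversionFinset v :=
  fun h' => (mem_inversionFinset.1 h').2 (hv ▸ simpleRoot_mem_posRoots h)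

/-! ### The length-zero element π. -/

theorem val_right_piElt (x : Fin N) :
    ((piElt N).right x : ℕ) = if (x : ℕ) = N - 1 then 0 else (x : ℕ) + 1 := by
  obtain ⟨n, rfl⟩ : ∃ n, N = n + 1 := ⟨N - 1, by have := NeZero.pos N; omega⟩
  simp only [piElt, SemidirectProduct.mul_right, right_translation, right_ofPerm, one_mul]
  rw [coe_finRotate]
  simp [Fin.ext_iff, Fin.val_last]

theorem shift_piElt (x : Fin N) : shift (piElt N) x = if (x : ℕ) = 0 then 1 else 0 := by
  simp only [piElt, shift_mul, shift_translation, shift_ofPerm, Pi.single_apply, Fin.ext_iff,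
    Fin.val_zero, Pi.zero_apply, add_zero]

/-- The element π rotates the indices cyclically, and its shift compensates exactly for the one
index that wraps around. So it has no inversions, and multiplying by it only relabels inversion
sets. -/
theorem actRoot_piElt_mem_posRoots_iff {α : Fin N × Fin N × ℤ} :
    actRoot (piElt N) α ∈ posRoots N ↔ α ∈ posRoots N := by
  obtain ⟨a, b, k⟩ := α
  simp only [posRoots, Set.mem_ofPred_eq, actRoot, Fin.lt_def, shift_piElt, val_right_piElt]
  have ha := a.isLt
  have hb := b.isLt
  by_cases h1 : (a : ℕ) = N - 1 <;> by_cases h2 : (b : ℕ) = N - 1 <;>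
    simp only [h1, h2, if_true, if_false, Nat.add_eq_zero_iff, one_ne_zero, and_false] <;> omega

theorem inversionFinset_mul_piElt (v : AffineWeyl N) :
    inversionFinset (v * piElt N) = (inversionFinset v).image (actRoot (piElt N)⁻¹) := by
  ext α
  simp only [mem_inversionFinset, Finset.mem_image, actRoot_mul]
  constructor
  · rintro ⟨h1, h2⟩
    exact ⟨_, ⟨actRoot_piElt_mem_posRoots_iff.2 h1, h2⟩, actRoot_inv_actRoot _ _⟩
  · rintro ⟨γ, ⟨h1, h2⟩, rfl⟩
    rw [← actRoot_piElt_mem_posRoots_iff, actRoot_actRoot_inv]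
    exact ⟨h1, h2⟩

theorem sum_inversionFinset_mul_piElt {M : Type*} [AddCommGroup M] (v : AffineWeyl N)
    (f : Fin N × Fin N × ℤ → M) :
    ∑ α ∈ inversionFinset (v * piElt N), f α =
      ∑ α ∈ inversionFinset v, f (actRoot (piElt N)⁻¹ α) := by
  rw [inversionFinset_mul_piElt, Finset.sum_image fun _ _ _ _ h => actRoot_injective _ h]

theorem sum_inversionFinset_mul_piElt_inv {M : Type*} [AddCommGroup M] (v : AffineWeyl N)
    (f : Fin N × Fin N × ℤ → M) :
    ∑ α ∈ inversionFinset (v * (piElt N)⁻¹), f α =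
      ∑ α ∈ inversionFinset v, f (actRoot (piElt N) α) := by
  have := sum_inversionFinset_mul_piElt (v * (piElt N)⁻¹) fun α => f (actRoot (piElt N) α)
  rw [inv_mul_cancel_right] at this
  simp only [actRoot_actRoot_inv] at this
  exact this.symm

/-! ### Generators of the affine Weyl group -/

variable (N) in
theorem closure_simpleReflection_piElt :
    Subgroup.closure ({w : AffineWeyl N | ∃ i : Fin N, i - 1 ≠ i ∧ w = simpleReflection i} ∪
      {piElt N}) = ⊤ := by
  set G := Subgroup.closure ({w : AffineWeyl N | ∃ i : Fin N, i - 1 ≠ i ∧ w = simpleReflection i} ∪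
      {piElt N}) with hG
  have hpi : piElt N ∈ G := Subgroup.subset_closure (Or.inr rfl)
  have hperm : ∀ σ : Equiv.Perm (Fin N), ofPerm σ ∈ G := by
    obtain ⟨n, rfl⟩ : ∃ n, N = n + 1 := ⟨N - 1, by have := NeZero.pos N; omega⟩
    have h : Submonoid.closure (Set.range fun i : Fin n => Equiv.swap i.castSucc i.succ) ≤
        G.toSubmonoid.comap (SemidirectProduct.inr : _ →* AffineWeyl (n + 1)) := by
      rw [Submonoid.closure_le]
      rintro _ ⟨i, rfl⟩
      have h1 : i.succ - 1 = i.castSucc := by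
        rw [sub_eq_iff_eq_add, Fin.coeSucc_eq_succ]
      refine Subgroup.subset_closure (Or.inl ⟨i.succ, ?_, ?_⟩)
      · rw [h1]; exact (Fin.castSucc_lt_succ).ne
      · rw [simpleReflection, h1, reflection, if_neg (Fin.succ_ne_zero i), neg_zero, zero_smul]
        exact (one_mul _).symm
    rw [Equiv.Perm.mclosure_swap_castSucc_succ] at h
    exact fun σ => h (Submonoid.mem_top σ)
  have hsingle : ∀ j : Fin N, translation (Pi.single j 1) ∈ G := by
    -- The rotation lies in the finite Weyl group, so it can be cancelled from π to leave the first
    -- translation. Conjugation by transpositions gives the other basis translations.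
    have h0 : translation (Pi.single (0 : Fin N) 1) ∈ G := by
      have := G.mul_mem hpi (G.inv_mem (hperm (finRotate N)))
      rwa [piElt, mul_inv_cancel_right] at this
    intro j
    have := G.mul_mem (G.mul_mem (hperm (Equiv.swap 0 j)) h0) (hperm (Equiv.swap 0 j))
    convert this using 1
    refine affineWeyl_ext ?_ fun i => ?_
    · simp [right_translation, right_ofPerm]
    · have h1 : Equiv.swap 0 j i = 0 ↔ i = j := by
        rw [← Equiv.eq_symm_apply]; simp
      simp [shift_mul, shift_translation, shift_ofPerm, right_ofPerm, Pi.single_apply, h1]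
  have htrans : ∀ η : Fin N → ℤ, translation η ∈ G := by
    let T : AddSubgroup (Fin N → ℤ) :=
      (G.comap (SemidirectProduct.inl : _ →* AffineWeyl N)).toAddSubgroup'
    intro η
    have : η ∈ T := by
      have h : η = ∑ j, η j • (Pi.single j 1 : Fin N → ℤ) := by
        ext i; simp [Finset.sum_apply, Pi.single_apply]
      rw [h]
      exact T.sum_mem fun j _ => T.zsmul_mem (hsingle j) _
    exact this
  refine eq_top_iff.2 fun w _ => ?_
  have : w = translation (shift w) * ofPerm w.right :=
    (SemidirectProduct.inl_left_mul_inr_right w).symm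
  rw [this]
  exact G.mul_mem (htrans _) (hperm _)

theorem affineWeyl_induction {P : AffineWeyl N → Prop} (one : P 1)
    (simple : ∀ (i : Fin N) (w : AffineWeyl N), i - 1 ≠ i → P w → P (simpleReflection i * w))
    (pi : ∀ w, P w → P (piElt N * w)) (pi_inv : ∀ w, P w → P ((piElt N)⁻¹ * w))
    (w : AffineWeyl N) : P w := by
  have hw : w ∈ Subgroup.closure ({w : AffineWeyl N | ∃ i : Fin N, i - 1 ≠ i ∧
      w = simpleReflection i} ∪ {piElt N}) := by
    rw [closure_simpleReflection_piElt]; trivial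
  induction hw using Subgroup.closure_induction_left with
  | one => exact one
  | mul_left x hx y _ ih =>
    rcases hx with ⟨i, hi, rfl⟩ | rfl
    · exact simple i y hi ih
    · exact pi y ih
  | inv_mul_cancel x hx y _ ih =>
    rcases hx with ⟨i, hi, rfl⟩ | rfl
    · rw [simpleReflection_inv]; exact simple i y hi ih
    · exact pi_inv y ih

end Simple

/-! ### A measure that decreases along the Bruhat order -/

/-- The squared displacement of the alcove point `-∑ i ε_i` (at level `N`) under `w`. -/
def displacement (w : AffineWeyl N) : ℕ :=
  (∑ i : Fin N, ((i : ℤ) - (w.right⁻¹ i : ℕ) + N * shift w i) ^ 2).toNat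

/-- With x the alcove point, `hpos` says that x lies on the positive side of the hyperplane of α,
and `hneg` that w x lies on the negative side, at value −m. The reflection adds m(ε_a − ε_b) to w x,
and the squared distance to x drops by exactly 2m(b − a + Nk), twice the product of two positive
integers. -/
theorem displacement_rootReflection_mul_lt (w : AffineWeyl N) {α : Fin N × Fin N × ℤ}
    (hα : α ∈ inversionFinset w⁻¹) : displacement (rootReflection α * w) < displacement w := by
  rw [mem_inversionFinset] at hα
  obtain ⟨h1, h2⟩ := hα
  have h0 := ne_of_mem_posRoots h1
  rw [← negRoot_mem_posRoots_iff (actRoot_ne _ h0)] at h2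
  have hs : ∀ i, shift w⁻¹ (w.right⁻¹ i) = -shift w i := by
    intro i
    have := shift_mul w w⁻¹ i
    rw [mul_inv_cancel, shift_one] at this
    simp only [Pi.zero_apply] at this
    omega
  obtain ⟨a, b, k⟩ := α
  set d : Fin N → ℤ := fun i => (i : ℤ) - (w.right⁻¹ i : ℕ) + N * shift w i with hd
  have hab : a ≠ b := h0
  have ha := a.isLt
  have hb := b.isLt
  have ha' := (w.right⁻¹ a).isLt
  have hb' := (w.right⁻¹ b).isLt
  have hpos : 0 < (b : ℤ) - a + N * k := by
    simp only [posRoots, Set.mem_ofPred_eq, Fin.lt_def] at h1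
    rcases h1 with h | h
    · nlinarith
    · nlinarith
  have hneg : 0 < ((w.right⁻¹ a : ℕ) : ℤ) - (w.right⁻¹ b : ℕ) - N * (k + shift w a - shift w b) := by
    simp only [posRoots, Set.mem_ofPred_eq, Fin.lt_def, negRoot, actRoot,
      SemidirectProduct.inv_right, hs] at h2
    rcases h2 with h | h
    · nlinarith
    · nlinarith
  set m : ℤ := ((w.right⁻¹ a : ℕ) : ℤ) - (w.right⁻¹ b : ℕ) - N * (k + shift w a - shift w b) with hm
  have hnew : ∀ i : Fin N, (i : ℤ) - ((rootReflection (a, b, k) * w).right⁻¹ i : ℕ)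
        + N * shift (rootReflection (a, b, k) * w) i
      = d i + m * ((if i = a then 1 else 0) - (if i = b then 1 else 0)) := by
    intro i
    simp only [SemidirectProduct.mul_right, mul_inv_rev, shift_mul, shift_rootReflection,
      right_rootReflection, Equiv.swap_inv, Equiv.Perm.mul_apply, hd, hm]
    by_cases hia : i = a
    · subst hia
      simp only [Equiv.swap_apply_left, hab, if_true, if_false]; ring
    · by_cases hib : i = b
      · subst hib
        simp only [Equiv.swap_apply_right, hia, if_true, if_false]; ring
      · simp only [Equiv.swap_apply_of_ne_of_ne hia hib, hia, hib, if_false]; ring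
  have hsum : ∑ i, (d i + m * ((if i = a then 1 else 0) - (if i = b then 1 else 0))) ^ 2
      = ∑ i, d i ^ 2 + (2 * m * (d a - d b) + 2 * m ^ 2) := by
    have : ∀ i, (d i + m * ((if i = a then 1 else 0) - (if i = b then 1 else 0))) ^ 2
        = d i ^ 2 + ((if i = a then 2 * m * d a + m ^ 2 else 0)
          + (if i = b then -2 * m * d b + m ^ 2 else 0)) := by
      intro i
      by_cases hia : i = a
      · subst hia
        simp only [hab, if_true, if_false]; ring
      · by_cases hib : i = b
        · subst hib
          simp only [hia, if_true, if_false]; ring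
        · simp only [hia, hib, if_false]; ring
    simp only [this, Finset.sum_add_distrib, Finset.sum_ite_eq', Finset.mem_univ, if_true]
    ring
  have hnn : 0 ≤ ∑ i, d i ^ 2 := Finset.sum_nonneg fun i _ => sq_nonneg _
  have hnn' : 0 ≤ ∑ i, (d i + m * ((if i = a then 1 else 0) - (if i = b then 1 else 0))) ^ 2 :=
    Finset.sum_nonneg fun i _ => sq_nonneg _
  have hdab : d a - d b + m = -((b : ℤ) - a + N * k) := by
    simp only [hd, hm]; ring
  unfold displacement
  simp only [hnew]
  rw [hsum] at hnn' ⊢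
  have : 2 * m * (d a - d b) + 2 * m ^ 2 = -(2 * (m * ((b : ℤ) - a + N * k))) := by
    linear_combination 2 * m * hdab
  have h3 := mul_pos hneg hpos
  change (∑ i, d i ^ 2 + _).toNat < (∑ i, d i ^ 2).toNat
  omega

end DDAHA

end

noncomputable section

namespace DDAHA

variable {N : ℕ}

/-! ### Minimal representatives have no fixed weight -/

theorem simpleRoot_of_val_succ [NeZero N] {i j : Fin N} (h : (i : ℕ) + 1 = j) :
    j - 1 = i ∧ simpleRoot j = (i, j, 0) ∧ simpleReflection j = ofPerm (Equiv.swap i j) := by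
  have hj : j ≠ 0 := fun hj => by
    rw [hj, Fin.val_zero] at h; omega
  have h1 : j - 1 = i := Fin.ext (by rw [val_sub_one, if_neg hj]; omega)
  refine ⟨h1, by rw [simpleRoot, h1, if_neg hj], ?_⟩
  rw [simpleReflection, h1, reflection, if_neg hj, neg_zero, zero_smul]
  exact one_mul _

/-- If the root became negative, w would be obtained from w s_j by a step that adds an inversion, so
w s_j would be strictly shorter. This positivity is the only consequence of minimality that is used.
-/
theorem actRoot_mem_posRoots_of_mem_minimalReps [NeZero N] {β : Composition N} {w : AffineWeyl N}
    (hw : w ∈ minimalReps β) {i j : Fin N} (hij : (i : ℕ) + 1 = j)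
    (hβ : β.index i = β.index j) : actRoot w (i, j, 0) ∈ posRoots N := by
  obtain ⟨h1, h2, h3⟩ := simpleRoot_of_val_succ hij
  have hne : j - 1 ≠ j := by rw [h1]; exact fun h => by rw [h] at hij; omega
  by_contra hneg
  have hle := hw _ (Subgroup.subset_closure ⟨i, j, hij, hβ, rfl⟩)
  rw [← h3] at hle
  have hv : actRoot (w * simpleReflection j) (simpleRoot j) ∈ posRoots N := by
    rw [actRoot_mul, actRoot_simpleReflection_simpleRoot hne, actRoot_negRoot,
      negRoot_mem_posRoots_iff (actRoot_ne w hne), h2]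
    exact hneg
  have h4 := inversionFinset_mul_simpleReflection hne hv
  rw [mul_assoc, simpleReflection_mul_self, mul_one] at h4
  rw [length_eq_card, length_eq_card, h4,
    Finset.card_insert_of_notMem (simpleRoot_notMem_image hne _),
    Finset.card_image_of_injective _ (actRoot_injective _)] at hle
  omega

/-! ### Blocks, positions in blocks, and the dominance condition. -/

theorem index_mono (β : Composition N) {i j : Fin N} (h : i ≤ j) : β.index i ≤ β.index j := by
  by_contra! h'
  have h1 := β.lt_sizeUpTo_index_succ j
  have h2 := β.sizeUpTo_index_le i
  have h3 : β.sizeUpTo (β.index j).succ ≤ β.sizeUpTo (β.index i) :=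
    β.monotone_sizeUpTo (by rw [Fin.lt_def] at h'; simpa using h')
  rw [Fin.le_def] at h
  omega

/-- Induction over pairs in the same block. -/
theorem sameBlock_induction {β : Composition N} {P : Fin N → Fin N → Prop}
    (step : ∀ i j : Fin N, (i : ℕ) + 1 = j → β.index i = β.index j → P i j)
    (trans : ∀ i j k : Fin N, P i j → P j k → P i k)
    {i j : Fin N} (hij : i < j) (hβ : β.index i = β.index j) : P i j := by
  obtain ⟨j, hj⟩ := j
  induction j with
  | zero => exact absurd hij (by simp [Fin.lt_def])
  | succ j ih =>
    have hj' : j < N := by omega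
    rw [Fin.lt_def] at hij
    change (i : ℕ) < j + 1 at hij
    by_cases h : (i : ℕ) = j
    · exact step _ _ (by simp [h]) hβ
    · have h1 : i < (⟨j, hj'⟩ : Fin N) := by rw [Fin.lt_def]; change (i : ℕ) < j; omega
      have h2 : (⟨j, hj'⟩ : Fin N) < ⟨j + 1, hj⟩ := by rw [Fin.lt_def]; exact Nat.lt_succ_self j
      have h3 : β.index i = β.index ⟨j, hj'⟩ :=
        le_antisymm (index_mono β h1.le) (hβ ▸ index_mono β h2.le)
      exact trans _ _ _ (ih hj' h1 h3) (step _ _ rfl (h3 ▸ hβ))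

theorem posRoots_add {i j k : Fin N} {a b : ℤ} (h : (i, j, a) ∈ posRoots N)
    (h' : (j, k, b) ∈ posRoots N) (hik : i ≠ k) : (i, k, a + b) ∈ posRoots N := by
  simp only [posRoots, Set.mem_ofPred_eq] at *
  omega

/-- A root inside a block is a sum of simple roots of that block, and a sum of positive roots that
is a root is positive. -/
theorem actRoot_mem_posRoots_of_sameBlock {β : Composition N} {w : AffineWeyl N}
    (hw : ∀ i j : Fin N, (i : ℕ) + 1 = j → β.index i = β.index j → actRoot w (i, j, 0) ∈ posRoots N)
    {i j : Fin N} (hij : i < j) (hβ : β.index i = β.index j) : actRoot w (i, j, 0) ∈ posRoots N := by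
  refine (sameBlock_induction (β := β) (P := fun i j => i < j ∧ actRoot w (i, j, 0) ∈ posRoots N)
    (fun i j h1 h2 => ⟨by rw [Fin.lt_def]; omega, hw i j h1 h2⟩) ?_ hij hβ).2
  rintro i j k ⟨h1, h2⟩ ⟨h3, h4⟩
  refine ⟨h1.trans h3, ?_⟩
  have := posRoots_add h2 h4 (fun h => (h1.trans h3).ne (w.right.injective h))
  simpa only [actRoot, zero_sub, neg_sub, sub_add_sub_cancel', sub_add_sub_cancel] using this

/-- The coordinate `ζ(ε_i^∨)`. -/
def weightCoord (ζ : Weight N) (i : Fin N) : ℂ := ζ (Pi.single i 1, 0)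

theorem apply_coroot (ζ : Weight N) (i j : Fin N) (k : ℤ) :
    ζ (coroot i j k) = weightCoord ζ i - weightCoord ζ j + k * ζ (c N) := by
  have : coroot i j k = (Pi.single i 1, 0) - (Pi.single j 1, 0) + (k : ℂ) • c N := by
    ext <;> simp [coroot, c]
  rw [this, map_add, map_sub, map_smul]; rfl

theorem weightCoord_of_fixed {w : AffineWeyl N} {ζ : Weight N} (h : affineAction w ζ = ζ)
    (i : Fin N) : weightCoord ζ i + shift w (w.right i) * ζ (c N) = weightCoord ζ (w.right i) := by
  conv_rhs => rw [← h]
  have : permCartan w.right⁻¹ (Pi.single (w.right i) 1, 0) = (Pi.single i 1, 0) := by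
    ext j
    · simp [permCartan, LinearMap.funLeft, Pi.single_apply]
    · simp [permCartan]
  simp only [weightCoord, affineAction, LinearMap.add_apply, LinearMap.comp_apply, this,
    LinearMap.smul_apply, smul_eq_mul]
  simp [latticeWeight, Pi.single_apply, mul_comm]

theorem weightCoord_sameBlock {β : Composition N} {ζ : Weight N} (hζ : ζ ∈ weightsBeta β)
    {i j : Fin N} (hij : i ≤ j) (hβ : β.index i = β.index j) :
    weightCoord ζ j - weightCoord ζ i = ((j : ℕ) : ℂ) - ((i : ℕ) : ℂ) := by
  rcases hij.eq_or_lt with rfl | hij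
  · simp
  refine sameBlock_induction (β := β)
    (P := fun i j => weightCoord ζ j - weightCoord ζ i = ((j : ℕ) : ℂ) - ((i : ℕ) : ℂ))
    (fun i j h1 h2 => ?_) (fun i j k h1 h2 => by linear_combination h1 + h2) hij hβ
  have := hζ i j h1 h2
  rw [apply_coroot, Int.cast_zero, zero_mul, add_zero] at this
  rw [← h1]; push_cast
  linear_combination -this

/-- Unifies the three dominance conditions by the order of (e, b − a). When a = b the value is
e·ζ(c), and n ≤ 0 would make ζ(c) = n/e a nonpositive rational. -/
theorem DominanceCondition.pos_of_eq {β : Composition N} {ζ : Weight N}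
    (hdom : DominanceCondition β ζ) {a b : Fin β.length} {e n : ℤ} (he : 0 < e ∨ e = 0 ∧ a < b)
    (h : ζ (coroot (blockStart β a) (blockStart β b) e) = n) : 0 < n := by
  by_contra! hn
  rcases lt_trichotomy a b with hab | rfl | hab
  · exact hdom.pos a b hab e (by omega) n hn h
  · have he : 0 < e := by simpa using he
    rw [apply_coroot, sub_self, zero_add] at h
    have he' : (e : ℂ) ≠ 0 := by exact_mod_cast he.ne'
    refine hdom.level ((n : ℚ) / e) (div_nonpos_of_nonpos_of_nonneg (by exact_mod_cast hn)
      (by exact_mod_cast he.le)) ?_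
    push_cast
    rw [eq_div_iff he', mul_comm, h]
  · exact hdom.neg b a hab e (by omega) n hn h

theorem val_blockStart (β : Composition N) (a : Fin β.length) :
    (blockStart β a : ℕ) = β.sizeUpTo a := by
  simp [blockStart]

theorem index_blockStart (β : Composition N) (a : Fin β.length) :
    β.index (blockStart β a) = a := β.index_embedding _ _

/-- The position of an index in its block, from `0`. -/
def blockPos (β : Composition N) (i : Fin N) : ℕ := i - β.sizeUpTo (β.index i)

theorem blockPos_add (β : Composition N) (i : Fin N) :
    blockPos β i + β.sizeUpTo (β.index i) = i :=
  Nat.sub_add_cancel (β.sizeUpTo_index_le i)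

theorem exists_blockPos_eq (β : Composition N) (i : Fin N) {p : ℕ} (hp : p ≤ blockPos β i) :
    ∃ j, β.index j = β.index i ∧ blockPos β j = p := by
  have h1 := blockPos_add β i
  let j : Fin N := ⟨p + β.sizeUpTo (β.index i), by omega⟩
  have hle : j ≤ i := by rw [Fin.le_def]; change p + _ ≤ _; omega
  have hge : blockStart β (β.index i) ≤ j := by
    rw [Fin.le_def, val_blockStart]; exact Nat.le_add_left _ _
  have hj : β.index j = β.index i := by
    refine le_antisymm (index_mono β hle) ?_
    have := index_mono β hge
    rwa [index_blockStart] at this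
  refine ⟨j, hj, ?_⟩
  have h2 := blockPos_add β j
  rw [hj] at h2
  change _ = p + _ at h2
  omega

theorem weightCoord_blockStart {β : Composition N} {ζ : Weight N} (hζ : ζ ∈ weightsBeta β)
    (i : Fin N) : weightCoord ζ i = weightCoord ζ (blockStart β (β.index i)) + blockPos β i := by
  have hle : blockStart β (β.index i) ≤ i := by
    rw [Fin.le_def, val_blockStart]; exact β.sizeUpTo_index_le i
  have h := weightCoord_sameBlock hζ hle (index_blockStart _ _)
  have h2 := blockPos_add β i
  rw [val_blockStart] at h
  have h3 : ((blockPos β i : ℂ)) + β.sizeUpTo (β.index i) = ((i : ℕ) : ℂ) := by exact_mod_cast h2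
  linear_combination h - h3

/-- Subtracting the leading coordinates of the two blocks turns the hypothesis into a root value
equal to the difference of the positions, which dominance makes positive. -/
theorem blockPos_lt_of_fixed {β : Composition N} {ζ : Weight N} (hζ : ζ ∈ weightsBeta β)
    (hdom : DominanceCondition β ζ) {i j : Fin N} {e : ℤ}
    (h : weightCoord ζ i + e * ζ (c N) = weightCoord ζ j)
    (he : 0 < e ∨ e = 0 ∧ β.index i < β.index j) : blockPos β i < blockPos β j := by
  have := hdom.pos_of_eq (n := (blockPos β j : ℤ) - blockPos β i) he (by
    rw [apply_coroot]
    push_cast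
    linear_combination h - weightCoord_blockStart hζ i + weightCoord_blockStart hζ j)
  omega

theorem blockPos_gt_of_fixed {β : Composition N} {ζ : Weight N} (hζ : ζ ∈ weightsBeta β)
    (hdom : DominanceCondition β ζ) {i j : Fin N} {e : ℤ}
    (h : weightCoord ζ i + e * ζ (c N) = weightCoord ζ j)
    (he : e < 0 ∨ e = 0 ∧ β.index j < β.index i) : blockPos β j < blockPos β i :=
  blockPos_lt_of_fixed hζ hdom (i := j) (j := i) (e := -e)
    (by push_cast; linear_combination -h) (by omega)

theorem eq_of_blockPos_eq {β : Composition N} {i j : Fin N} (h : β.index i = β.index j)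
    (h' : blockPos β i = blockPos β j) : i = j := by
  have h1 := blockPos_add β i
  have h2 := blockPos_add β j
  rw [h] at h1
  exact Fin.ext (by omega)

/-- Strong induction on the position p in the block: every index at position p is fixed with zero
shift. For i = w(j), the position of j cannot be below p, as j would be fixed already. Equal
positions leave no room for a shift or a change of block. Positions above p contradict the
positivity hypothesis. -/
theorem eq_one_of_affineAction_eq {β : Composition N} {ζ : Weight N} (hζ : ζ ∈ weightsBeta β)
    (hdom : DominanceCondition β ζ) {w : AffineWeyl N}
    (hw : ∀ i j : Fin N, (i : ℕ) + 1 = j → β.index i = β.index j → actRoot w (i, j, 0) ∈ posRoots N)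
    (hfix : affineAction w ζ = ζ) : w = 1 := by
  have hval := weightCoord_of_fixed hfix
  have key : ∀ p, ∀ i, blockPos β i = p → w.right i = i ∧ shift w i = 0 := by
    intro p
    induction p using Nat.strong_induction_on with
    | _ p ih =>
      intro i hi
      obtain ⟨j, rfl⟩ := w.right.surjective i
      have hj := hval j
      rcases lt_trichotomy (blockPos β j) p with hp | hp | hp
      · have h1 := (ih _ hp j rfl).1
        rw [h1] at hi
        omega
      · have e0 : shift w (w.right j) = 0 := by
          rcases lt_trichotomy (shift w (w.right j)) 0 with h | h | h
          · exact absurd (blockPos_gt_of_fixed hζ hdom hj (Or.inl h)) (by omega)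
          · exact h
          · exact absurd (blockPos_lt_of_fixed hζ hdom hj (Or.inl h)) (by omega)
        have hidx : β.index j = β.index (w.right j) := by
          rcases lt_trichotomy (β.index j) (β.index (w.right j)) with h | h | h
          · exact absurd (blockPos_lt_of_fixed hζ hdom hj (Or.inr ⟨e0, h⟩)) (by omega)
          · exact h
          · exact absurd (blockPos_gt_of_fixed hζ hdom hj (Or.inr ⟨e0, h⟩)) (by omega)
        have h1 : j = w.right j := eq_of_blockPos_eq hidx (by omega)
        rw [← h1] at e0 ⊢
        exact ⟨h1.symm, e0⟩
      · exfalso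
        have h1 : ¬ (0 < shift w (w.right j) ∨ shift w (w.right j) = 0 ∧
            β.index j < β.index (w.right j)) := fun h =>
          absurd (blockPos_lt_of_fixed hζ hdom hj h) (by omega)
        have h1' : β.index j = β.index (w.right j) → shift w (w.right j) ≠ 0 := by
          intro h2 h3
          rw [h3, Int.cast_zero, zero_mul, add_zero, weightCoord_blockStart hζ j,
            weightCoord_blockStart hζ (w.right j), h2] at hj
          have : blockPos β j = blockPos β (w.right j) := by exact_mod_cast add_left_cancel hj
          omega
        -- The index k precedes j in the same block, at position p. Passing from j to w(j) lowers
        -- the position, so the pair (shift, block change) of j is lexicographically negative.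
        -- Smaller positions are already fixed, so w(k) has position at least p and the pair of k is
        -- not negative. Together these make the image of the root from k to j negative.
        obtain ⟨k, hk1, hk2⟩ := exists_blockPos_eq β j hp.le
        have hk := hval k
        have hkp : p ≤ blockPos β (w.right k) := by
          by_contra! h
          have h2 := (ih _ h _ rfl).1
          rw [w.right.injective h2] at h
          omega
        have h2 : ¬ (shift w (w.right k) < 0 ∨ shift w (w.right k) = 0 ∧
            β.index (w.right k) < β.index k) := fun h =>
          absurd (blockPos_gt_of_fixed hζ hdom hk h) (by omega)
        have hkj : k < j := by
          have h3 := blockPos_add β k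
          have h4 := blockPos_add β j
          rw [hk1] at h3
          rw [Fin.lt_def]; omega
        have h3 := actRoot_mem_posRoots_of_sameBlock hw hkj hk1
        have h4 : w.right k ≤ w.right j → β.index (w.right k) ≤ β.index (w.right j) :=
          index_mono β
        simp only [posRoots, Set.mem_ofPred_eq, actRoot] at h3
        rw [hk1] at h2
        omega
  refine affineWeyl_ext (Equiv.ext fun i => (key _ i rfl).1) fun i => ?_
  rw [(key _ i rfl).2, shift_one]; rfl

end DDAHA

end

noncomputable section

namespace DDAHA

variable {N : ℕ} [NeZero N]

/-! ### Relations in the Hecke algebra -/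

theorem ofW_one : ofW (1 : AffineWeyl N) = 1 :=
  (RingQuot.mkAlgHom_rel ℂ Rel.one).trans (map_one _)

theorem ofW_mul (w v : AffineWeyl N) : ofW (w * v) = ofW w * ofW v :=
  (RingQuot.mkAlgHom_rel ℂ (Rel.mul w v)).trans (map_mul _ _ _)

theorem ofT_comm (ξ ξ' : Cartan N) : ofT ξ * ofT ξ' = ofT ξ' * ofT ξ :=
  (map_mul _ _ _).symm.trans ((RingQuot.mkAlgHom_rel ℂ (Rel.comm ξ ξ')).trans (map_mul _ _ _))

theorem ofW_simple_mul_ofT (i : Fin N) (ξ : Cartan N) :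
    ofW (simpleReflection i) * ofT ξ
        - ofT (actCartan (simpleReflection i) ξ) * ofW (simpleReflection i)
      = algebraMap ℂ (Hecke N) (-rootVal (simpleRoot i) ξ) := by
  have h := RingQuot.mkAlgHom_rel ℂ (Rel.simple i ξ)
  rw [map_sub, map_mul, map_mul, AlgHom.commutes] at h
  exact h

theorem ofW_piElt_mul_ofT (ξ : Cartan N) :
    ofW (piElt N) * ofT ξ = ofT (actCartan (piElt N) ξ) * ofW (piElt N) :=
  (map_mul _ _ _).symm.trans ((RingQuot.mkAlgHom_rel ℂ (Rel.pi ξ)).trans (map_mul _ _ _))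

theorem ofT_mul_ofW_simple {i : Fin N} (h : i - 1 ≠ i) (ξ : Cartan N) :
    ofT ξ * ofW (simpleReflection i) =
      ofW (simpleReflection i) * ofT (actCartan (simpleReflection i) ξ)
        - algebraMap ℂ (Hecke N) (rootVal (simpleRoot i) ξ) := by
  have h1 := ofW_simple_mul_ofT i (actCartan (simpleReflection i) ξ)
  have h2 : rootVal (simpleRoot i) (actCartan (simpleReflection i) ξ)
      = -rootVal (simpleRoot i) ξ := by
    have := rootVal_actRoot (simpleReflection i) (simpleRoot i) ξ
    rw [simpleReflection_inv, actRoot_simpleReflection_simpleRoot h, rootVal_negRoot] at this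
    exact this.symm
  rw [← actCartan_mul, simpleReflection_mul_self, actCartan_one, h2, neg_neg] at h1
  rw [← h1]; abel

theorem ofT_mul_ofW_piElt (ξ : Cartan N) :
    ofT ξ * ofW (piElt N) = ofW (piElt N) * ofT (actCartan (piElt N)⁻¹ ξ) := by
  rw [ofW_piElt_mul_ofT, ← actCartan_mul, mul_inv_cancel, actCartan_one]

theorem ofT_mul_ofW_piElt_inv (ξ : Cartan N) :
    ofT ξ * ofW (piElt N)⁻¹ = ofW (piElt N)⁻¹ * ofT (actCartan (piElt N) ξ) := by
  have h := congrArg (fun x => ofW (piElt N)⁻¹ * x * ofW (piElt N)⁻¹) (ofW_piElt_mul_ofT ξ)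
  simp only [mul_assoc] at h
  rw [← ofW_mul, mul_inv_cancel, ofW_one, mul_one, ← mul_assoc, ← ofW_mul, inv_mul_cancel, ofW_one,
    one_mul] at h
  exact h

omit [NeZero N] in
theorem rootReflection_actRoot_mul (v w : AffineWeyl N) (α : Fin N × Fin N × ℤ) :
    rootReflection (actRoot v α) * (v * w) = v * (rootReflection α * w) := by
  rw [← mul_assoc, ← mul_rootReflection, mul_assoc]

/-- The commutation relation between `𝔱'` and `W`. -/
theorem ofT_mul_ofW (w : AffineWeyl N) : ∀ ξ : Cartan N,
    ofT ξ * ofW w = ofW w * ofT (actCartan w⁻¹ ξ)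
      - ∑ α ∈ inversionFinset w⁻¹, rootVal α ξ • ofW (rootReflection α * w) := by
  induction w using affineWeyl_induction with
  | one =>
    intro ξ
    have h : inversionFinset (1 : AffineWeyl N)⁻¹ = ∅ := by
      ext α; simp [mem_inversionFinset, actRoot_one]
    rw [h, Finset.sum_empty, sub_zero, inv_one, actCartan_one, ofW_one, one_mul, mul_one]
  | simple i w hi ih =>
    intro ξ
    -- Since s_α = s_{−α} while α(ξ) changes sign, the summand is odd. The sum formula therefore
    -- applies whether or not s_i lengthens w.
    have hf : ∀ α, rootVal (negRoot α) ξ • ofW (rootReflection (negRoot α) *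
        (simpleReflection i * w))
        = -(rootVal α ξ • ofW (rootReflection α * (simpleReflection i * w))) := fun α => by
      rw [rootVal_negRoot, rootReflection_negRoot, neg_smul]
    rw [mul_inv_rev, simpleReflection_inv, sum_inversionFinset_mul_simpleReflection hi w⁻¹ hf,
      ofW_mul, ← mul_assoc, ofT_mul_ofW_simple hi, sub_mul, mul_assoc, ih, mul_sub, Finset.mul_sum,
      actCartan_mul, ← mul_assoc, ← Algebra.smul_def, ← simpleReflection_eq, ← mul_assoc,
      simpleReflection_mul_self, one_mul]
    have h : ∀ α, rootVal (actRoot (simpleReflection i) α) ξ •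
        ofW (rootReflection (actRoot (simpleReflection i) α) * (simpleReflection i * w)) =
        ofW (simpleReflection i) *
          rootVal α (actCartan (simpleReflection i) ξ) • ofW (rootReflection α * w) := fun α => by
      rw [rootVal_actRoot, simpleReflection_inv, rootReflection_actRoot_mul, ofW_mul,
        mul_smul_comm]
    simp only [h]
    abel
  | pi w ih =>
    intro ξ
    rw [mul_inv_rev, sum_inversionFinset_mul_piElt_inv, ofW_mul, ← mul_assoc, ofT_mul_ofW_piElt,
      mul_assoc, ih, mul_sub, Finset.mul_sum, actCartan_mul, mul_assoc]
    congr 1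
    refine Finset.sum_congr rfl fun α _ => ?_
    rw [rootVal_actRoot, rootReflection_actRoot_mul, ofW_mul (piElt N), mul_smul_comm]
  | pi_inv w ih =>
    intro ξ
    rw [mul_inv_rev, inv_inv, sum_inversionFinset_mul_piElt, ofW_mul, ← mul_assoc,
      ofT_mul_ofW_piElt_inv, mul_assoc, ih, mul_sub, Finset.mul_sum, actCartan_mul, mul_assoc]
    congr 1
    refine Finset.sum_congr rfl fun α _ => ?_
    rw [rootVal_actRoot, inv_inv, rootReflection_actRoot_mul, ofW_mul (piElt N)⁻¹, mul_smul_comm]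

theorem hecke_induction {P : Hecke N → Prop} (scalar : ∀ a : ℂ, P (algebraMap ℂ (Hecke N) a))
    (add : ∀ x y, P x → P y → P (x + y)) (mul : ∀ x y, P x → P y → P (x * y))
    (weyl : ∀ w, P (ofW w)) (cartan : ∀ ξ, P (ofT ξ)) (x : Hecke N) : P x := by
  obtain ⟨y, rfl⟩ := RingQuot.mkAlgHom_surjective ℂ (Rel N) x
  induction y using FreeAlgebra.induction with
  | grade0 a => rw [AlgHom.commutes]; exact scalar a
  | grade1 g =>
    rcases g with w | ξ
    · exact weyl w
    · exact cartan ξ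
  | mul a b ha hb => rw [map_mul]; exact mul _ _ ha hb
  | add a b ha hb => rw [map_add]; exact add _ _ ha hb

theorem hecke_smul_mem {V : Type*} [AddCommGroup V] [Module ℂ V] [Module (Hecke N) V]
    [IsScalarTower ℂ (Hecke N) V] {K : Submodule ℂ V} (hW : ∀ w : AffineWeyl N, ∀ v ∈ K, ofW w • v ∈ K)
    (hT : ∀ ξ : Cartan N, ∀ v ∈ K, ofT ξ • v ∈ K) (h : Hecke N) : ∀ v ∈ K, h • v ∈ K := by
  induction h using hecke_induction with
  | scalar a => intro v hv; rw [algebraMap_smul]; exact K.smul_mem a hv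
  | add x y hx hy => intro v hv; rw [add_smul]; exact K.add_mem (hx v hv) (hy v hv)
  | mul x y hx hy => intro v hv; rw [mul_smul]; exact hx _ (hy v hv)
  | weyl w => exact hW w
  | cartan ξ => exact hT ξ

end DDAHA

end

noncomputable section

namespace DDAHA

variable {N : ℕ}

/-! ### The module induced from a character of `S[𝔱']`, realized on `ℂ[W]` -/

theorem actCartan_rootReflection {α : Fin N × Fin N × ℤ} (h : α.1 ≠ α.2.1) (ξ : Cartan N) :
    actCartan (rootReflection α) ξ = ξ - rootVal α ξ • coroot α.1 α.2.1 α.2.2 := by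
  ext i
  · simp only [actCartan_fst, right_rootReflection, Equiv.swap_inv, Equiv.swap_apply_def, rootVal,
      coroot, Prod.fst_sub, Prod.smul_fst, Pi.sub_apply, Pi.smul_apply, Pi.single_apply,
      smul_eq_mul]
    by_cases h1 : i = α.1
    · subst h1; simp [h]
    · by_cases h2 : i = α.2.1
      · subst h2; simp [h1]
      · simp [h1, h2]
  · simp only [actCartan_snd, shift_rootReflection, right_rootReflection, Equiv.swap_inv, rootVal,
      coroot, Prod.snd_sub, Prod.smul_snd, smul_eq_mul]
    push_cast
    simp only [mul_sub, sub_mul, Finset.sum_sub_distrib, mul_ite, mul_one, mul_zero, ite_mul,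
      zero_mul, Finset.sum_ite_eq', Finset.mem_univ, if_true, Equiv.swap_apply_left,
      Equiv.swap_apply_right]
    ring

variable (N) in
/-- The space `ℂ[W]`. -/
abbrev WeylSpace : Type := AffineWeyl N →₀ ℂ

/-- The basis vector of `ℂ[W]` given by `w`. -/
def basisVec (w : AffineWeyl N) : WeylSpace N := Finsupp.single w 1

theorem weylSpace_hom_ext {M : Type*} [AddCommGroup M] [Module ℂ M] {f g : WeylSpace N →ₗ[ℂ] M}
    (h : ∀ w, f (basisVec w) = g (basisVec w)) : f = g :=
  Finsupp.lhom_ext' fun w => LinearMap.ext_ring (h w)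

/-- Left multiplication by `w` on `ℂ[W]`. -/
def weylOp (w : AffineWeyl N) : Module.End ℂ (WeylSpace N) := Finsupp.lmapDomain ℂ ℂ (w * ·)

theorem weylOp_basisVec (w v : AffineWeyl N) : weylOp w (basisVec v) = basisVec (w * v) := by
  simp [weylOp, basisVec]

/-- The operator by which `ξ ∈ 𝔱'` acts on `ℂ[W]`, where `1` has weight `ζ`. -/
def cartanOp (ζ : Weight N) (ξ : Cartan N) : Module.End ℂ (WeylSpace N) :=
  Finsupp.linearCombination ℂ fun w => ζ (actCartan w⁻¹ ξ) • basisVec w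
    - ∑ α ∈ inversionFinset w⁻¹, rootVal α ξ • basisVec (rootReflection α * w)

theorem cartanOp_basisVec (ζ : Weight N) (ξ : Cartan N) (w : AffineWeyl N) :
    cartanOp ζ ξ (basisVec w) = ζ (actCartan w⁻¹ ξ) • basisVec w
      - ∑ α ∈ inversionFinset w⁻¹, rootVal α ξ • basisVec (rootReflection α * w) := by
  simp [cartanOp, basisVec]

theorem cartanOp_add (ζ : Weight N) (ξ ξ' : Cartan N) :
    cartanOp ζ (ξ + ξ') = cartanOp ζ ξ + cartanOp ζ ξ' := by
  refine weylSpace_hom_ext fun w => ?_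
  simp only [LinearMap.add_apply, cartanOp_basisVec, actCartan_add, map_add, rootVal_add, add_smul,
    Finset.sum_add_distrib]
  abel

theorem cartanOp_smul (ζ : Weight N) (a : ℂ) (ξ : Cartan N) :
    cartanOp ζ (a • ξ) = a • cartanOp ζ ξ := by
  refine weylSpace_hom_ext fun w => ?_
  simp only [LinearMap.smul_apply, cartanOp_basisVec, actCartan_smul, map_smul, rootVal_smul,
    smul_sub, Finset.smul_sum, smul_smul, smul_eq_mul]

theorem cartanOp_basisVec_one (ζ : Weight N) (ξ : Cartan N) :
    cartanOp ζ ξ (basisVec 1) = ζ ξ • basisVec 1 := by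
  have h : inversionFinset (1 : AffineWeyl N)⁻¹ = ∅ := by
    ext α; simp [mem_inversionFinset, actRoot_one]
  rw [cartanOp_basisVec, h, Finset.sum_empty, sub_zero, inv_one, actCartan_one]

variable [NeZero N]

theorem cartanOp_weylOp_simple {i : Fin N} (hi : i - 1 ≠ i) (ζ : Weight N) (ξ : Cartan N)
    (v : WeylSpace N) :
    cartanOp ζ ξ (weylOp (simpleReflection i) v) =
      weylOp (simpleReflection i) (cartanOp ζ (actCartan (simpleReflection i) ξ) v)
        - rootVal (simpleRoot i) ξ • v := by
  have : cartanOp ζ ξ ∘ₗ weylOp (simpleReflection i) =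
      weylOp (simpleReflection i) ∘ₗ cartanOp ζ (actCartan (simpleReflection i) ξ)
        - rootVal (simpleRoot i) ξ • LinearMap.id := by
    refine weylSpace_hom_ext fun w => ?_
    have hf : ∀ α, rootVal (negRoot α) ξ • basisVec (rootReflection (negRoot α) *
        (simpleReflection i * w))
        = -(rootVal α ξ • basisVec (rootReflection α * (simpleReflection i * w))) := fun α => by
      rw [rootVal_negRoot, rootReflection_negRoot, neg_smul]
    have h : ∀ α, rootVal (actRoot (simpleReflection i) α) ξ •
        basisVec (rootReflection (actRoot (simpleReflection i) α) * (simpleReflection i * w)) =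
        rootVal α (actCartan (simpleReflection i) ξ) •
          basisVec (simpleReflection i * (rootReflection α * w)) := fun α => by
      rw [rootVal_actRoot, simpleReflection_inv, rootReflection_actRoot_mul]
    simp only [LinearMap.comp_apply, LinearMap.sub_apply, LinearMap.smul_apply, LinearMap.id_apply,
      weylOp_basisVec, cartanOp_basisVec, map_sub, map_smul, map_sum]
    rw [mul_inv_rev, simpleReflection_inv, sum_inversionFinset_mul_simpleReflection hi w⁻¹ hf,
      ← simpleReflection_eq, ← mul_assoc (simpleReflection i), simpleReflection_mul_self, one_mul,
      actCartan_mul]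
    simp only [h]
    abel
  exact LinearMap.congr_fun this v

theorem cartanOp_weylOp_piElt (ζ : Weight N) (ξ : Cartan N) (v : WeylSpace N) :
    cartanOp ζ ξ (weylOp (piElt N) v) =
      weylOp (piElt N) (cartanOp ζ (actCartan (piElt N)⁻¹ ξ) v) := by
  have : cartanOp ζ ξ ∘ₗ weylOp (piElt N) =
      weylOp (piElt N) ∘ₗ cartanOp ζ (actCartan (piElt N)⁻¹ ξ) := by
    refine weylSpace_hom_ext fun w => ?_
    simp only [LinearMap.comp_apply, weylOp_basisVec, cartanOp_basisVec, map_sub, map_smul, map_sum]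
    rw [mul_inv_rev, sum_inversionFinset_mul_piElt_inv, actCartan_mul]
    congr 1
    refine Finset.sum_congr rfl fun α _ => ?_
    rw [rootVal_actRoot, rootReflection_actRoot_mul]
  exact LinearMap.congr_fun this v

theorem cartanOp_weylOp_piElt_inv (ζ : Weight N) (ξ : Cartan N) (v : WeylSpace N) :
    cartanOp ζ ξ (weylOp (piElt N)⁻¹ v) =
      weylOp (piElt N)⁻¹ (cartanOp ζ (actCartan (piElt N) ξ) v) := by
  have : cartanOp ζ ξ ∘ₗ weylOp (piElt N)⁻¹ =
      weylOp (piElt N)⁻¹ ∘ₗ cartanOp ζ (actCartan (piElt N) ξ) := by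
    refine weylSpace_hom_ext fun w => ?_
    simp only [LinearMap.comp_apply, weylOp_basisVec, cartanOp_basisVec, map_sub, map_smul, map_sum]
    rw [mul_inv_rev, inv_inv, sum_inversionFinset_mul_piElt, actCartan_mul]
    congr 1
    refine Finset.sum_congr rfl fun α _ => ?_
    rw [rootVal_actRoot, inv_inv, rootReflection_actRoot_mul]
  exact LinearMap.congr_fun this v

/-- By induction on w, moving both operators past s_i leaves, besides the term known to be
symmetric, −α_i(ξ)s_i(ξ') − α_i(ξ')ξ. Substituting s_i(ξ') = ξ' − α_i(ξ')α_i^∨ shows that this too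
is symmetric in ξ and ξ'. -/
theorem cartanOp_comm (ζ : Weight N) (ξ ξ' : Cartan N) (v : WeylSpace N) :
    cartanOp ζ ξ (cartanOp ζ ξ' v) = cartanOp ζ ξ' (cartanOp ζ ξ v) := by
  have key : ∀ w : AffineWeyl N, ∀ ξ ξ' : Cartan N,
      cartanOp ζ ξ (cartanOp ζ ξ' (basisVec w)) = cartanOp ζ ξ' (cartanOp ζ ξ (basisVec w)) := by
    intro w
    induction w using affineWeyl_induction with
    | one =>
      intro ξ ξ'
      simp only [cartanOp_basisVec_one, map_smul]
      rw [smul_comm]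
    | simple i w hi ih =>
      intro ξ ξ'
      have h : ∀ η : Cartan N, cartanOp ζ (actCartan (simpleReflection i) η) (basisVec w)
          = cartanOp ζ η (basisVec w) - rootVal (simpleRoot i) η •
            cartanOp ζ (coroot (simpleRoot i).1 (simpleRoot i).2.1 (simpleRoot i).2.2)
              (basisVec w) := by
        intro η
        rw [simpleReflection_eq, actCartan_rootReflection (α := simpleRoot i) hi, sub_eq_add_neg,
          ← neg_smul, cartanOp_add, cartanOp_smul, LinearMap.add_apply, LinearMap.smul_apply,
          neg_smul, ← sub_eq_add_neg]
      simp only [← weylOp_basisVec, cartanOp_weylOp_simple hi, map_sub, map_smul]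
      rw [ih, h ξ, h ξ']
      module
    | pi w ih =>
      intro ξ ξ'
      simp only [← weylOp_basisVec, cartanOp_weylOp_piElt]
      rw [ih]
    | pi_inv w ih =>
      intro ξ ξ'
      simp only [← weylOp_basisVec, cartanOp_weylOp_piElt_inv]
      rw [ih]
  have : cartanOp ζ ξ ∘ₗ cartanOp ζ ξ' = cartanOp ζ ξ' ∘ₗ cartanOp ζ ξ :=
    weylSpace_hom_ext fun w => key w ξ ξ'
  exact LinearMap.congr_fun this v

/-- The action of the generators on `ℂ[W]`. -/
def preRep (ζ : Weight N) : Pre N →ₐ[ℂ] Module.End ℂ (WeylSpace N) :=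
  FreeAlgebra.lift ℂ (Sum.elim weylOp (cartanOp ζ))

omit [NeZero N] in
theorem preRep_preW (ζ : Weight N) (w : AffineWeyl N) : preRep ζ (preW w) = weylOp w := by
  simp [preRep, preW]

omit [NeZero N] in
theorem preRep_preT (ζ : Weight N) (ξ : Cartan N) : preRep ζ (preT ξ) = cartanOp ζ ξ := by
  simp [preRep, preT]

theorem simpleReflection_eq_one {i : Fin N} (hi : i - 1 = i) : simpleReflection i = 1 := by
  rw [simpleReflection, hi, reflection, sub_self, smul_zero, Equiv.swap_self]
  rfl

theorem preRep_rel (ζ : Weight N) ⦃x y : Pre N⦄ (h : Rel N x y) : preRep ζ x = preRep ζ y := by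
  cases h with
  | one =>
    rw [preRep_preW, map_one]
    exact weylSpace_hom_ext fun w => by rw [weylOp_basisVec, one_mul]; rfl
  | mul w w' =>
    rw [map_mul, preRep_preW, preRep_preW, preRep_preW]
    exact weylSpace_hom_ext fun v => by
      rw [Module.End.mul_apply, weylOp_basisVec, weylOp_basisVec, weylOp_basisVec, mul_assoc]
  | add ξ ξ' => rw [map_add, preRep_preT, preRep_preT, preRep_preT, cartanOp_add]
  | smul a ξ => rw [map_smul, preRep_preT, preRep_preT, cartanOp_smul]
  | comm ξ ξ' =>
    rw [map_mul, map_mul, preRep_preT, preRep_preT]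
    exact LinearMap.ext fun v => cartanOp_comm ζ ξ ξ' v
  | simple i ξ =>
    rw [map_sub, map_mul, map_mul, preRep_preW, preRep_preT, preRep_preT, AlgHom.commutes]
    refine LinearMap.ext fun v => ?_
    rw [LinearMap.sub_apply, Module.End.mul_apply, Module.End.mul_apply,
      Module.algebraMap_end_apply]
    -- The equality happens only for N = 1, where s_0 = 1 and the relation reduces to commutation
    -- with the identity.
    by_cases hi : i - 1 = i
    · have : weylOp (1 : AffineWeyl N) = LinearMap.id :=
        weylSpace_hom_ext fun w => by rw [weylOp_basisVec, one_mul]; rfl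
      rw [simpleReflection_eq_one hi, actCartan_one, hi, this]
      simp
    · have h2 : rootVal (simpleRoot i) (actCartan (simpleReflection i) ξ)
          = -rootVal (simpleRoot i) ξ := by
        have := rootVal_actRoot (simpleReflection i) (simpleRoot i) ξ
        rw [simpleReflection_inv, actRoot_simpleReflection_simpleRoot hi, rootVal_negRoot] at this
        exact this.symm
      rw [cartanOp_weylOp_simple hi, h2, ← actCartan_mul, simpleReflection_mul_self, actCartan_one]
      simp only [rootVal, simpleRoot]
      module
  | pi ξ =>
    rw [map_mul, map_mul, preRep_preW, preRep_preT, preRep_preT]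
    refine LinearMap.ext fun v => ?_
    rw [Module.End.mul_apply, Module.End.mul_apply, cartanOp_weylOp_piElt, ← actCartan_mul,
      inv_mul_cancel, actCartan_one]

/-- The representation of the Hecke algebra on `ℂ[W]` induced from the character `ζ`. -/
def weylRep (ζ : Weight N) : Hecke N →ₐ[ℂ] Module.End ℂ (WeylSpace N) :=
  RingQuot.liftAlgHom ℂ ⟨preRep ζ, preRep_rel ζ⟩

theorem weylRep_ofW (ζ : Weight N) (w : AffineWeyl N) : weylRep ζ (ofW w) = weylOp w :=
  (RingQuot.liftAlgHom_mkAlgHom_apply ℂ (preRep ζ) (preRep_rel ζ) (preW w)).trans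
    (preRep_preW ζ w)

theorem weylRep_ofT (ζ : Weight N) (ξ : Cartan N) : weylRep ζ (ofT ξ) = cartanOp ζ ξ :=
  (RingQuot.liftAlgHom_mkAlgHom_apply ℂ (preRep ζ) (preRep_rel ζ) (preT ξ)).trans
    (preRep_preT ζ ξ)

/-! ### The cyclic vector of an induced module is nonzero -/

/-- The kernel of `ℂ[W] → ℂ[W / W̄_β]`, spanned by the differences of adjacent basis vectors. -/
def parabolicKernel (β : Composition N) : Submodule ℂ (WeylSpace N) :=
  Submodule.span ℂ {v | ∃ (w : AffineWeyl N) (i j : Fin N), (i : ℕ) + 1 = j ∧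
    β.index i = β.index j ∧ v = basisVec (w * ofPerm (Equiv.swap i j)) - basisVec w}

omit [NeZero N] in
theorem basisVec_sub_mem_parabolicKernel {β : Composition N} {u : Equiv.Perm (Fin N)}
    (hu : u ∈ parabolic β) : ∀ w : AffineWeyl N,
      basisVec (w * ofPerm u) - basisVec w ∈ parabolicKernel β := by
  induction hu using Subgroup.closure_induction with
  | mem u hu =>
    obtain ⟨i, j, h1, h2, rfl⟩ := hu
    exact fun w => Submodule.subset_span ⟨w, i, j, h1, h2, rfl⟩
  | one => intro w; rw [ofPerm_one, mul_one, sub_self]; exact Submodule.zero_mem _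
  | mul u v _ _ hu hv =>
    intro w
    have := Submodule.add_mem _ (hv (w * ofPerm u)) (hu w)
    rwa [sub_add_sub_cancel, mul_assoc, ← ofPerm_mul] at this
  | inv u _ hu =>
    intro w
    have := Submodule.neg_mem _ (hu (w * ofPerm u⁻¹))
    rwa [mul_assoc, ← ofPerm_mul, inv_mul_cancel, ofPerm_one, mul_one, neg_sub] at this

/-- The expansion at w s_j has one reflection more than that at w, namely in α = w(α_j), and s_α w
s_j = w. Since ζ(α_j^∨) = −1, the eigenvalue at w s_j exceeds that at w by α(ξ), exactly the
coefficient of the extra term. All terms then pair into differences of adjacent basis vectors. -/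
theorem cartanOp_mem_parabolicKernel_of_pos {β : Composition N} {ζ : Weight N}
    (hζ : ζ ∈ weightsBeta β) (ξ : Cartan N) {w : AffineWeyl N} {i j : Fin N} (hij : (i : ℕ) + 1 = j)
    (hβ : β.index i = β.index j) (hw : actRoot w (simpleRoot j) ∈ posRoots N) :
    cartanOp ζ ξ (basisVec (w * simpleReflection j) - basisVec w) ∈ parabolicKernel β := by
  obtain ⟨h1, h2, h3⟩ := simpleRoot_of_val_succ hij
  have hne : j - 1 ≠ j := by rw [h1]; exact fun h => by rw [h] at hij; omega
  have hmem : ∀ v : AffineWeyl N,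
      basisVec (v * simpleReflection j) - basisVec v ∈ parabolicKernel β := fun v => by
    rw [h3]; exact Submodule.subset_span ⟨v, i, j, hij, hβ, rfl⟩
  have hroot : actRoot w⁻¹ (actRoot w (simpleRoot j)) = simpleRoot j := actRoot_inv_actRoot _ _
  have hval : ζ (actCartan (simpleReflection j * w⁻¹) ξ)
      = ζ (actCartan w⁻¹ ξ) + rootVal (simpleRoot j) (actCartan w⁻¹ ξ) := by
    have := hζ i j hij hβ
    rw [actCartan_mul, simpleReflection_eq, actCartan_rootReflection (α := simpleRoot j) hne,
      map_sub, map_smul, h2, this, smul_eq_mul]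
    ring
  rw [map_sub, cartanOp_basisVec, cartanOp_basisVec, mul_inv_rev, simpleReflection_inv,
    inversionFinset_simpleReflection_mul hne hw hroot,
    Finset.sum_insert (notMem_inversionFinset_of_actRoot_eq hne hroot), ← mul_assoc,
    ← mul_rootReflection, ← simpleReflection_eq, mul_assoc, simpleReflection_mul_self, mul_one,
    rootVal_actRoot, hval]
  have hsum : ∑ α ∈ inversionFinset w⁻¹, rootVal α ξ •
      (basisVec (rootReflection α * w * simpleReflection j) - basisVec (rootReflection α * w))
        ∈ parabolicKernel β :=
    Submodule.sum_mem _ fun α _ => Submodule.smul_mem _ _ (hmem _)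
  have := Submodule.sub_mem _ (Submodule.smul_mem _ (ζ (actCartan w⁻¹ ξ)
    + rootVal (simpleRoot j) (actCartan w⁻¹ ξ)) (hmem w)) hsum
  convert this using 1
  simp only [smul_sub, Finset.sum_sub_distrib, mul_assoc]
  module

theorem cartanOp_mem_parabolicKernel {β : Composition N} {ζ : Weight N}
    (hζ : ζ ∈ weightsBeta β) (ξ : Cartan N) {v : WeylSpace N} (hv : v ∈ parabolicKernel β) :
    cartanOp ζ ξ v ∈ parabolicKernel β := by
  induction hv using Submodule.span_induction with
  | mem v hv =>
    obtain ⟨w, i, j, hij, hβ, rfl⟩ := hv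
    obtain ⟨h1, h2, h3⟩ := simpleRoot_of_val_succ hij
    have hne : j - 1 ≠ j := by rw [h1]; exact fun h => by rw [h] at hij; omega
    rw [← h3]
    by_cases hw : actRoot w (simpleRoot j) ∈ posRoots N
    · exact cartanOp_mem_parabolicKernel_of_pos hζ ξ hij hβ hw
    · have hw' : actRoot (w * simpleReflection j) (simpleRoot j) ∈ posRoots N := by
        rw [actRoot_mul, actRoot_simpleReflection_simpleRoot hne, actRoot_negRoot,
          negRoot_mem_posRoots_iff (actRoot_ne w hne)]
        exact hw
      have := Submodule.neg_mem _ (cartanOp_mem_parabolicKernel_of_pos hζ ξ hij hβ hw')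
      rwa [mul_assoc, simpleReflection_mul_self, mul_one, ← map_neg, neg_sub] at this
  | zero => rw [map_zero]; exact Submodule.zero_mem _
  | add x y _ _ hx hy => rw [map_add]; exact Submodule.add_mem _ hx hy
  | smul a x _ hx => rw [map_smul]; exact Submodule.smul_mem _ _ hx

omit [NeZero N] in
theorem weylOp_mem_parabolicKernel {β : Composition N} (w : AffineWeyl N) {v : WeylSpace N}
    (hv : v ∈ parabolicKernel β) : weylOp w v ∈ parabolicKernel β := by
  induction hv using Submodule.span_induction with
  | mem v hv =>
    obtain ⟨v, i, j, hij, hβ, rfl⟩ := hv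
    rw [map_sub, weylOp_basisVec, weylOp_basisVec, ← mul_assoc]
    exact Submodule.subset_span ⟨w * v, i, j, hij, hβ, rfl⟩
  | zero => rw [map_zero]; exact Submodule.zero_mem _
  | add x y _ _ hx hy => rw [map_add]; exact Submodule.add_mem _ hx hy
  | smul a x _ hx => rw [map_smul]; exact Submodule.smul_mem _ _ hx

theorem weylRep_mem_parabolicKernel {β : Composition N} {ζ : Weight N} (hζ : ζ ∈ weightsBeta β)
    (h : Hecke N) : ∀ v ∈ parabolicKernel β, weylRep ζ h v ∈ parabolicKernel β := by
  induction h using hecke_induction with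
  | scalar a =>
    intro v hv
    rw [AlgHom.commutes, Module.algebraMap_end_apply]
    exact Submodule.smul_mem _ a hv
  | add x y hx hy =>
    intro v hv
    rw [map_add, LinearMap.add_apply]
    exact Submodule.add_mem _ (hx v hv) (hy v hv)
  | mul x y hx hy => intro v hv; rw [map_mul]; exact hx _ (hy v hv)
  | weyl w => rw [weylRep_ofW]; exact fun v hv => weylOp_mem_parabolicKernel w hv
  | cartan ξ => rw [weylRep_ofT]; exact fun v hv => cartanOp_mem_parabolicKernel hζ ξ hv

/-- In the model, the inducing left ideal maps the basis vector of 1 into the stable kernel. The sum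
of coefficients vanishes on that kernel but equals 1 on this vector, so 1 is not in the ideal. -/
theorem cyclicVector_ne_zero {β : Composition N} {ζ : Weight N} (hζ : ζ ∈ weightsBeta β) :
    cyclicVector β ζ ≠ 0 := by
  intro h0
  have h1 : (1 : Hecke N) ∈ inducedIdeal β ζ := (Submodule.Quotient.mk_eq_zero _).1 h0
  have key : ∀ x ∈ inducedIdeal β ζ, weylRep ζ x (basisVec 1) ∈ parabolicKernel β := by
    intro x hx
    induction hx using Submodule.span_induction with
    | mem x hx =>
      rcases hx with ⟨u, hu, rfl⟩ | ⟨ξ, rfl⟩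
      · have := basisVec_sub_mem_parabolicKernel hu 1
        rw [one_mul] at this
        rwa [map_sub, map_one, LinearMap.sub_apply, weylRep_ofW, weylOp_basisVec, mul_one]
      · rw [map_sub, AlgHom.commutes, LinearMap.sub_apply, weylRep_ofT, cartanOp_basisVec_one,
          Module.algebraMap_end_apply, sub_self]
        exact Submodule.zero_mem _
    | zero => rw [map_zero]; exact Submodule.zero_mem _
    | add x y _ _ hx hy => rw [map_add]; exact Submodule.add_mem _ hx hy
    | smul a x _ hx =>
      rw [smul_eq_mul, map_mul]; exact weylRep_mem_parabolicKernel hζ a _ hx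
  have h2 : parabolicKernel β ≤
      LinearMap.ker (Finsupp.linearCombination ℂ fun _ : AffineWeyl N => (1 : ℂ)) := by
    refine Submodule.span_le.2 ?_
    rintro _ ⟨w, i, j, _, _, rfl⟩
    simp [basisVec]
  have h3 := h2 (key 1 h1)
  simp [basisVec] at h3

end DDAHA

end

noncomputable section

namespace DDAHA

variable {N : ℕ} [NeZero N]

/-! ### The structure of the induced modules -/

section Induced

variable (β : Composition N) (ζ : Weight N)

theorem ofPerm_smul_cyclicVector {u : Equiv.Perm (Fin N)} (hu : u ∈ parabolic β) :
    ofW (ofPerm u) • cyclicVector β ζ = cyclicVector β ζ := by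
  rw [← sub_eq_zero, cyclicVector, ← Submodule.Quotient.mk_smul, ← Submodule.Quotient.mk_sub,
    Submodule.Quotient.mk_eq_zero, smul_eq_mul, mul_one]
  exact Submodule.subset_span (Or.inl ⟨u, hu, rfl⟩)

theorem ofT_smul_cyclicVector (ξ : Cartan N) :
    ofT ξ • cyclicVector β ζ = ζ ξ • cyclicVector β ζ := by
  rw [← sub_eq_zero, ← algebraMap_smul (Hecke N) (ζ ξ), ← sub_smul, cyclicVector,
    ← Submodule.Quotient.mk_smul, Submodule.Quotient.mk_eq_zero, smul_eq_mul, mul_one]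
  exact Submodule.subset_span (Or.inr ⟨ξ, rfl⟩)

theorem exists_smul_cyclicVector (v : Induced β ζ) : ∃ h : Hecke N, v = h • cyclicVector β ζ := by
  obtain ⟨h, rfl⟩ := Submodule.Quotient.mk_surjective _ v
  refine ⟨h, ?_⟩
  rw [cyclicVector, ← Submodule.Quotient.mk_smul, smul_eq_mul, mul_one]

theorem ofT_smul_ofW_smul_cyclicVector (w : AffineWeyl N) (ξ : Cartan N) :
    ofT ξ • ofW w • cyclicVector β ζ = ζ (actCartan w⁻¹ ξ) • ofW w • cyclicVector β ζ
      - ∑ α ∈ inversionFinset w⁻¹,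
        rootVal α ξ • ofW (rootReflection α * w) • cyclicVector β ζ := by
  rw [smul_smul, ofT_mul_ofW, sub_smul, mul_smul, ofT_smul_cyclicVector, Finset.sum_smul,
    smul_comm]
  simp only [smul_assoc]

theorem span_ofW_smul_cyclicVector :
    Submodule.span ℂ (Set.range fun w : AffineWeyl N => ofW w • cyclicVector β ζ) = ⊤ := by
  refine eq_top_iff.2 fun v _ => ?_
  obtain ⟨h, rfl⟩ := exists_smul_cyclicVector β ζ v
  have hmem : ∀ w : AffineWeyl N, ofW w • cyclicVector β ζ ∈
      Submodule.span ℂ (Set.range fun w : AffineWeyl N => ofW w • cyclicVector β ζ) :=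
    fun w => Submodule.subset_span ⟨w, rfl⟩
  refine hecke_smul_mem (fun w v hv => ?_) (fun ξ v hv => ?_) h _ (by
    have := hmem 1
    rwa [ofW_one, one_smul] at this)
  · induction hv using Submodule.span_induction with
    | mem v hv =>
      obtain ⟨w', rfl⟩ := hv
      dsimp only
      rw [smul_smul, ← ofW_mul]
      exact hmem _
    | zero => rw [smul_zero]; exact Submodule.zero_mem _
    | add x y _ _ hx hy => rw [smul_add]; exact Submodule.add_mem _ hx hy
    | smul a x _ hx => rw [smul_comm]; exact Submodule.smul_mem _ _ hx
  · induction hv using Submodule.span_induction with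
    | mem v hv =>
      obtain ⟨w', rfl⟩ := hv
      dsimp only
      rw [ofT_smul_ofW_smul_cyclicVector]
      exact Submodule.sub_mem _ (Submodule.smul_mem _ _ (hmem _))
        (Submodule.sum_mem _ fun α _ => Submodule.smul_mem _ _ (hmem _))
    | zero => rw [smul_zero]; exact Submodule.zero_mem _
    | add x y _ _ hx hy => rw [smul_add]; exact Submodule.add_mem _ hx hy
    | smul a x _ hx => rw [smul_comm]; exact Submodule.smul_mem _ _ hx

/-- The products of elements `ξ - a` of `S[𝔱']` with `a ≠ ζ(ξ)`. -/
def offWeightMonoid : Submonoid (Hecke N) :=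
  Submonoid.closure {h | ∃ (ξ : Cartan N) (a : ℂ), a ≠ ζ ξ ∧ h = ofT ξ - algebraMap ℂ (Hecke N) a}

variable {ζ}

theorem commute_ofT_of_mem_offWeightMonoid {h : Hecke N} (hh : h ∈ offWeightMonoid ζ)
    (ξ : Cartan N) : Commute h (ofT ξ) := by
  induction hh using Submonoid.closure_induction with
  | mem x hx =>
    obtain ⟨η, a, _, rfl⟩ := hx
    exact Commute.sub_left (ofT_comm η ξ) (Algebra.commutes a _)
  | one => exact Commute.one_left _
  | mul x y _ _ hx hy => exact hx.mul_left hy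

theorem commute_of_mem_offWeightMonoid {h k : Hecke N} (hh : h ∈ offWeightMonoid ζ)
    (hk : k ∈ offWeightMonoid ζ) : Commute h k := by
  induction hk using Submonoid.closure_induction with
  | mem x hx =>
    obtain ⟨η, a, _, rfl⟩ := hx
    exact (commute_ofT_of_mem_offWeightMonoid hh η).sub_right (Algebra.commutes a h).symm
  | one => exact Commute.one_right _
  | mul x y _ _ hx hy => exact hx.mul_right hy

theorem exists_smul_cyclicVector_of_mem_offWeightMonoid {h : Hecke N}
    (hh : h ∈ offWeightMonoid ζ) :
    ∃ a : ℂ, a ≠ 0 ∧ h • cyclicVector β ζ = a • cyclicVector β ζ := by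
  induction hh using Submonoid.closure_induction with
  | mem x hx =>
    obtain ⟨η, a, ha, rfl⟩ := hx
    refine ⟨ζ η - a, sub_ne_zero.2 ha.symm, ?_⟩
    rw [sub_smul, ofT_smul_cyclicVector, algebraMap_smul, sub_smul]
  | one => exact ⟨1, one_ne_zero, by rw [one_smul, one_smul]⟩
  | mul x y _ _ hx hy =>
    obtain ⟨a, ha, hx⟩ := hx
    obtain ⟨b, hb, hy⟩ := hy
    exact ⟨b * a, mul_ne_zero hb ha, by rw [mul_smul, hy, smul_comm, hx, smul_smul]⟩

variable (ζ)

/-- The sum of the generalized weight spaces of the induced module for the weights other than `ζ`: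
the vectors killed by a product of elements `ξ - a` with `a ≠ ζ(ξ)`. -/
def offWeightSpace : Submodule ℂ (Induced β ζ) where
  carrier := {v | ∃ h ∈ offWeightMonoid ζ, h • v = 0}
  zero_mem' := ⟨1, Submonoid.one_mem _, smul_zero _⟩
  add_mem' := by
    rintro v v' ⟨h, hh, hv⟩ ⟨h', hh', hv'⟩
    refine ⟨h * h', Submonoid.mul_mem _ hh hh', ?_⟩
    rw [smul_add, mul_smul h h' v', hv', smul_zero, add_zero,
      (commute_of_mem_offWeightMonoid hh hh').eq, mul_smul, hv, smul_zero]
  smul_mem' := by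
    rintro a v ⟨h, hh, hv⟩
    exact ⟨h, hh, by rw [smul_comm, hv, smul_zero]⟩

/-- The operator ξ − a acts on the cyclic vector by the nonzero scalar ζ(ξ) − a, so the component
along it can be divided out. The corrected vector is killed by one further factor. -/
theorem mem_of_ofT_sub_smul_mem {ξ : Cartan N} {a : ℂ} (ha : a ≠ ζ ξ) {v : Induced β ζ}
    (hv : (ofT ξ - algebraMap ℂ (Hecke N) a) • v ∈
      Submodule.span ℂ {cyclicVector β ζ} ⊔ offWeightSpace β ζ) :
    v ∈ Submodule.span ℂ {cyclicVector β ζ} ⊔ offWeightSpace β ζ := by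
  obtain ⟨x, hx, y, ⟨h, hh, hy⟩, hxy⟩ := Submodule.mem_sup.1 hv
  obtain ⟨b, rfl⟩ := Submodule.mem_span_singleton.1 hx
  have hne : ζ ξ - a ≠ 0 := sub_ne_zero.2 ha.symm
  refine Submodule.mem_sup.2 ⟨(b / (ζ ξ - a)) • cyclicVector β ζ,
    Submodule.mem_span_singleton.2 ⟨_, rfl⟩, v - (b / (ζ ξ - a)) • cyclicVector β ζ,
    ⟨h * (ofT ξ - algebraMap ℂ (Hecke N) a),
      Submonoid.mul_mem _ hh (Submonoid.subset_closure ⟨ξ, a, ha, rfl⟩), ?_⟩, by abel⟩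
  have : (ofT ξ - algebraMap ℂ (Hecke N) a) • (v - (b / (ζ ξ - a)) • cyclicVector β ζ) = y := by
    rw [smul_sub, ← hxy, smul_comm, sub_smul (ofT ξ), ofT_smul_cyclicVector, algebraMap_smul,
      ← sub_smul, smul_smul, div_mul_cancel₀ _ hne]
    abel
  rw [mul_smul, this, hy]

/-! ### Splitting off the line of weight ζ. -/

variable {β ζ}

/-- Strong induction on the displacement of w. If w ≠ 1 keeps the block roots positive, wζ ≠ ζ
supplies ξ for which ξ − (wζ)(ξ) maps the vector of w to a combination of closer ones. Otherwise a
right factor from W̄_β moves w closer without changing its vector. -/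
theorem span_cyclicVector_sup_offWeightSpace (hζ : ζ ∈ weightsBeta β)
    (hdom : DominanceCondition β ζ) :
    Submodule.span ℂ {cyclicVector β ζ} ⊔ offWeightSpace β ζ = ⊤ := by
  rw [eq_top_iff, ← span_ofW_smul_cyclicVector, Submodule.span_le]
  rintro _ ⟨w, rfl⟩
  dsimp only
  induction hd : displacement w using Nat.strong_induction_on generalizing w with
  | _ d ih =>
    subst hd
    by_cases hw : ∀ i j : Fin N, (i : ℕ) + 1 = j → β.index i = β.index j →
        actRoot w (i, j, 0) ∈ posRoots N
    · by_cases h1 : w = 1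
      · rw [h1, ofW_one, one_smul]
        exact Submodule.mem_sup_left (Submodule.mem_span_singleton_self _)
      · have hne : affineAction w ζ ≠ ζ := fun h => h1 (eq_one_of_affineAction_eq hζ hdom hw h)
        obtain ⟨ξ, hξ⟩ : ∃ ξ, affineAction w ζ ξ ≠ ζ ξ := by
          by_contra! h
          exact hne (LinearMap.ext h)
        rw [affineAction_apply] at hξ
        refine mem_of_ofT_sub_smul_mem β ζ hξ ?_
        rw [sub_smul, ofT_smul_ofW_smul_cyclicVector, algebraMap_smul, sub_sub_cancel_left]
        exact Submodule.neg_mem _ (Submodule.sum_mem _ fun α hα => Submodule.smul_mem _ _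
          (ih _ (displacement_rootReflection_mul_lt w hα) _ rfl))
    · push Not at hw
      obtain ⟨i, j, hij, hβ, hw⟩ := hw
      have hne : i ≠ j := fun h => by rw [h] at hij; omega
      -- Reflecting w on the left in −w(α_j) gives w s_j, so the same inequality for the
      -- displacement also handles right multiplication.
      have hmem : negRoot (actRoot w (i, j, 0)) ∈ inversionFinset w⁻¹ := by
        rw [mem_inversionFinset, negRoot_mem_posRoots_iff (actRoot_ne w hne), actRoot_negRoot,
          actRoot_inv_actRoot, negRoot_mem_posRoots_iff hne, not_not]
        refine ⟨hw, Or.inl ⟨?_, le_rfl⟩⟩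
        rw [Fin.lt_def]; change (i : ℕ) < j; omega
      have h2 := displacement_rootReflection_mul_lt w hmem
      obtain ⟨_, h3, h4⟩ := simpleRoot_of_val_succ hij
      rw [rootReflection_negRoot, ← mul_rootReflection, ← h3, ← simpleReflection_eq, h4] at h2
      have := ih _ h2 _ rfl
      rwa [ofW_mul, mul_smul,
        ofPerm_smul_cyclicVector β ζ (Subgroup.subset_closure ⟨i, j, hij, hβ, rfl⟩)] at this

/-- Generalized eigenspaces of one operator for different eigenvalues are disjoint, so each factor ξ
− a is injective here. Stability is carried along because the induction over products has to apply
injectivity repeatedly. -/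
theorem smul_mem_genWeightSpace {h : Hecke N} (hh : h ∈ offWeightMonoid ζ) :
    ∀ v ∈ genWeightSpace (N := N) (Induced β ζ) ζ,
      h • v ∈ genWeightSpace (N := N) (Induced β ζ) ζ ∧ (h • v = 0 → v = 0) := by
  induction hh using Submonoid.closure_induction with
  | mem x hx =>
    obtain ⟨η, a, ha, rfl⟩ := hx
    intro v hv
    rw [genWeightSpace, Submodule.mem_iInf] at hv ⊢
    constructor
    · intro ξ
      have hcomm : Commute (Algebra.lsmul ℂ ℂ (Induced β ζ) (ofT ξ))
          (Algebra.lsmul ℂ ℂ (Induced β ζ) (ofT η - algebraMap ℂ (Hecke N) a)) := by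
        refine Commute.map (Commute.sub_right (ofT_comm ξ η) ?_) _
        exact (Algebra.commutes a _).symm
      exact Module.End.mapsTo_maxGenEigenspace_of_comm hcomm (ζ ξ) (hv ξ)
    · intro h0
      rw [sub_smul, algebraMap_smul, sub_eq_zero] at h0
      have h1 : v ∈ Module.End.maxGenEigenspace
          (Algebra.lsmul ℂ ℂ (Induced β ζ) (ofT η)) a := by
        rw [Module.End.mem_maxGenEigenspace]
        refine ⟨1, ?_⟩
        rw [pow_one, LinearMap.sub_apply, sub_eq_zero]
        exact h0
      have h2 := Module.End.disjoint_genEigenspace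
        (Algebra.lsmul ℂ ℂ (Induced β ζ) (ofT η)) ha ⊤ ⊤
      exact (Submodule.disjoint_def.1 h2) v h1 (hv η)
  | one => intro v hv; rw [one_smul]; exact ⟨hv, id⟩
  | mul x y _ _ hx hy =>
    intro v hv
    rw [mul_smul]
    exact ⟨(hx _ (hy v hv).1).1, fun h => (hy v hv).2 ((hx _ (hy v hv).1).2 h)⟩

variable (β ζ) in
theorem cyclicVector_mem_genWeightSpace :
    cyclicVector β ζ ∈ genWeightSpace (N := N) (Induced β ζ) ζ := by
  rw [genWeightSpace, Submodule.mem_iInf]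
  intro ξ
  rw [Module.End.mem_maxGenEigenspace]
  refine ⟨1, ?_⟩
  rw [pow_one, LinearMap.sub_apply, sub_eq_zero]
  exact ofT_smul_cyclicVector β ζ ξ

theorem genWeightSpace_eq_span (hζ : ζ ∈ weightsBeta β) (hdom : DominanceCondition β ζ) :
    genWeightSpace (N := N) (Induced β ζ) ζ = Submodule.span ℂ {cyclicVector β ζ} := by
  refine le_antisymm (fun v hv => ?_)
    ((Submodule.span_singleton_le_iff_mem _ _).2 (cyclicVector_mem_genWeightSpace β ζ))
  have hv' : v ∈ Submodule.span ℂ {cyclicVector β ζ} ⊔ offWeightSpace β ζ := by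
    rw [span_cyclicVector_sup_offWeightSpace hζ hdom]; trivial
  obtain ⟨x, hx, y, ⟨h, hh, hy⟩, rfl⟩ := Submodule.mem_sup.1 hv'
  have hx' := (Submodule.span_singleton_le_iff_mem _ _).2
    (cyclicVector_mem_genWeightSpace β ζ) hx
  have := (smul_mem_genWeightSpace hh y ((Submodule.add_mem_iff_right _ hx').1 hv)).2 hy
  rwa [this, add_zero]

/-- An element of the off-weight monoid that kills the second component of v scales the first by a
nonzero number. If that component were nonzero, the submodule would contain the cyclic vector and be
everything. -/
theorem mem_offWeightSpace_of_ne_top (hζ : ζ ∈ weightsBeta β) (hdom : DominanceCondition β ζ)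
    {M : Submodule (Hecke N) (Induced β ζ)} (hM : M ≠ ⊤) {v : Induced β ζ} (hv : v ∈ M) :
    v ∈ offWeightSpace β ζ := by
  have hv' : v ∈ Submodule.span ℂ {cyclicVector β ζ} ⊔ offWeightSpace β ζ := by
    rw [span_cyclicVector_sup_offWeightSpace hζ hdom]; trivial
  obtain ⟨x, hx, y, hy', rfl⟩ := Submodule.mem_sup.1 hv'
  obtain ⟨h, hh, hy⟩ := id hy'
  obtain ⟨b, rfl⟩ := Submodule.mem_span_singleton.1 hx
  obtain ⟨a, ha, hcyc⟩ := exists_smul_cyclicVector_of_mem_offWeightMonoid β hh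
  by_cases hb : b = 0
  · rwa [hb, zero_smul, zero_add]
  · refine absurd (eq_top_iff.2 fun u _ => ?_) hM
    have h1 := M.smul_mem h hv
    rw [smul_add, hy, add_zero, smul_comm, hcyc, smul_smul] at h1
    have h2 := M.smul_mem (algebraMap ℂ (Hecke N) (b * a)⁻¹) h1
    rw [algebraMap_smul, smul_smul, inv_mul_cancel₀ (mul_ne_zero hb ha), one_smul] at h2
    obtain ⟨k, rfl⟩ := exists_smul_cyclicVector β ζ u
    exact M.smul_mem k h2

theorem cyclicVector_notMem_offWeightSpace (hζ : ζ ∈ weightsBeta β) :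
    cyclicVector β ζ ∉ offWeightSpace β ζ := by
  rintro ⟨h, hh, h0⟩
  obtain ⟨a, ha, hcyc⟩ := exists_smul_cyclicVector_of_mem_offWeightMonoid β hh
  rw [hcyc] at h0
  exact (smul_ne_zero ha (cyclicVector_ne_zero hζ)) h0

/-! ### The unique maximal submodule. -/

variable (β ζ)

/-- The largest `H`-submodule without vectors of weight `ζ`. -/
def radicalSubmodule : Submodule (Hecke N) (Induced β ζ) where
  carrier := {v | ∀ h : Hecke N, h • v ∈ offWeightSpace β ζ}
  zero_mem' h := by rw [smul_zero]; exact Submodule.zero_mem _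
  add_mem' hv hv' h := by rw [smul_add]; exact Submodule.add_mem _ (hv h) (hv' h)
  smul_mem' k v hv h := by rw [smul_smul]; exact hv (h * k)

variable {β ζ}

theorem le_radicalSubmodule (hζ : ζ ∈ weightsBeta β) (hdom : DominanceCondition β ζ)
    {M : Submodule (Hecke N) (Induced β ζ)} (hM : M ≠ ⊤) : M ≤ radicalSubmodule β ζ :=
  fun _ hv h => mem_offWeightSpace_of_ne_top hζ hdom hM (M.smul_mem h hv)

theorem radicalSubmodule_ne_top (hζ : ζ ∈ weightsBeta β) : radicalSubmodule β ζ ≠ ⊤ := by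
  intro h
  have h1 : cyclicVector β ζ ∈ radicalSubmodule β ζ := h ▸ Submodule.mem_top
  have h2 := h1 1
  rw [one_smul] at h2
  exact cyclicVector_notMem_offWeightSpace hζ h2

/-- Simple quotients correspond to maximal submodules, and a proper submodule containing every other
proper submodule is the only maximal one. -/
theorem existsUnique_isSimpleModule_quotient (hζ : ζ ∈ weightsBeta β)
    (hdom : DominanceCondition β ζ) :
    ∃! M : Submodule (Hecke N) (Induced β ζ), IsSimpleModule (Hecke N) (Induced β ζ ⧸ M) := by
  refine ⟨radicalSubmodule β ζ, isSimpleModule_iff_isCoatom.2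
    ⟨radicalSubmodule_ne_top hζ, fun M hM => ?_⟩, fun M hM => ?_⟩
  · by_contra h
    exact hM.not_ge (le_radicalSubmodule hζ hdom h)
  · have hM := isSimpleModule_iff_isCoatom.1 hM
    exact ((hM.le_iff.1 (le_radicalSubmodule hζ hdom hM.1)).resolve_left
      (radicalSubmodule_ne_top hζ)).symm

end Induced

end DDAHA

end

theorem mainTheorem4 (N : ℕ) [NeZero N] (β : Composition N) (ζ : DDAHA.Weight N)
    (hζ : ζ ∈ DDAHA.weightsBeta β) (hdom : DDAHA.DominanceCondition β ζ) :
    (∀ w ∈ DDAHA.minimalReps β, w ≠ 1 → DDAHA.affineAction w ζ ≠ ζ) ∧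
    (DDAHA.cyclicVector β ζ ≠ 0 ∧
      DDAHA.genWeightSpace (N := N) (DDAHA.Induced β ζ) ζ =
        Submodule.span ℂ {DDAHA.cyclicVector β ζ}) ∧
    (∃! M : Submodule (DDAHA.Hecke N) (DDAHA.Induced β ζ),
      IsSimpleModule (DDAHA.Hecke N) (DDAHA.Induced β ζ ⧸ M)) :=
  ⟨fun _ hw hw1 h => hw1 (DDAHA.eq_one_of_affineAction_eq hζ hdom
      (fun _ _ hij hβ => DDAHA.actRoot_mem_posRoots_of_mem_minimalReps hw hij hβ) h),
    ⟨DDAHA.cyclicVector_ne_zero hζ, DDAHA.genWeightSpace_eq_span hζ hdom⟩,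
    DDAHA.existsUnique_isSimpleModule_quotient hζ hdom⟩
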